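/- **Setting.** Let $k,l\ge 1$, $n=k+l$, and let $h=h_T\oplus h_N$ be a fixed nondegenerate symmetric bilinear form on $\mathbb R^n=\mathbb R^k\oplus\mathbb R^{l}$ with $\mathbb R^k\perp\mathbb R^l$. Indices $\alpha,\beta,\gamma,\gamma_i$ are tangential (they run over $1,\dots,k$), indices $\alpha',\beta',\gamma',\gamma'_i,\delta'$ are normal (they run over $k+1,\dots,n$), and $i,j$ run over $1,\dots,n$. Let $(M^n,g)$ be a smooth pseudo-Riemannian manifold with Levi-Civita connection $\nabla$, let $\Sigma^k\subset M$ be an embedded nondegenerate submanifold with inclusion $\iota$, and let $p\in\Sigma$. A *submanifold geodesic normal coordinate system* at $p$ (with reference form $h$) is a smooth coordinate system $z=(x,u)=(x^1,\dots,x^k,u^{k+1},\dots,u^n)$ of $M$ near $p$, with $z(p)=(0,0)$, $g_{ij}(p)=h_{ij}$, and 1. $\Sigma=\{u=0\}$ in the coordinate domain; 2. for each $x$ near $0$, the curve $t\mapsto(tx,0)$ is a geodesic of $\iota^*g$; 3. along $\Sigma$ near $p$, the fields $\partial_{\alpha'}$ are normal to $\Sigma$, and they are parallel, for the induced connection of the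 normal bundle $N\Sigma$, along the curves $t\mapsto (tx,0)$, $x$ near $0$; 4. for each $(x,u)$ near $(0,0)$, the curve $t\mapsto (x,tu)$ is a geodesic of $g$. Let $R_{ijab}=g(R(\partial_a,\partial_b)\partial_j,\partial_i)$ with $R(X,Y)=\nabla_X\nabla_Y-\nabla_Y\nabla_X-\nabla_{[X,Y]}$, and let $L_{\alpha\beta\gamma'}=g(\nabla_{\partial_\alpha}\partial_\beta,\partial_{\gamma'})$ be the second fundamental form $L(X,Y)=(\nabla_XY)^\perp$ with its normal index lowered. Indices after a comma denote partial derivatives in the coordinates $z$ for $g_{ij}$, covariant derivatives with respect to $\nabla$ for $R$, and covariant derivatives with respect to the induced connections of $T\Sigma$ and $N\Sigma$ for $L$. Parentheses $(\cdots)$ denote symmetrization (with weight one) over the enclosed indices other than those between bars $|\cdot|$. **Proposition.** For given $k,l,h$ there is, for each $i,j$ and each list $K$ of derivative indices, a real polynomial $Q_{ij,K}$, all of whose terms have degree at least $2$, in (finitely many of) the components of the tensors $\nabla^mR$ and $\overline\nabla{}^mL$, $m\ge0$, such that for every $(M,g)$, $\Sigma$, $p$ and every submanifold geodesic normal coordinate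 system as above, the following identities hold at $p$, where $\equiv$ means equality up to adding the value at $p$ of the polynomial $Q_{ij,K}$ that belongs to the left-hand side: $$ \begin{aligned} g_{\alpha\beta}&\equiv h_{\alpha\beta}\\ g_{\alpha\beta,\gamma}&\equiv 0\\ g_{\alpha\beta,\gamma_1\cdots \gamma_M}&\equiv 2\tfrac{M-1}{M+1}R_{\alpha(\gamma_1\gamma_2|\beta|,\gamma_3\cdots \gamma_M)} && M\ge 2\\ g_{\alpha\beta,\gamma_1\cdots \gamma_M\gamma'}&\equiv-2L_{\alpha\beta\gamma',\gamma_1\cdots \gamma_M} && M\ge 0\\ g_{\alpha\beta,\gamma_1\cdots \gamma_M\gamma_1'\cdots \gamma_N'}&\equiv 2R_{\alpha(\gamma_1'\gamma_2'|\beta|,\gamma_3'\cdots \gamma_N')\gamma_1\cdots \gamma_M} && M\ge 0,\ N\ge 2\\ g_{\alpha\beta',\gamma_1\cdots \gamma_M}&\equiv 0 && M\ge 0\\ g_{\alpha\beta',\gamma'}&\equiv 0\\ g_{\alpha\beta',\gamma_1\cdots \gamma_M\gamma'}&\equiv -\tfrac{M}{M+1}R_{\beta'\gamma'\alpha(\gamma_1,\gamma_2\cdots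 \gamma_M)} && M\ge 1\\ g_{\alpha\beta',\gamma_1\cdots \gamma_M\gamma_1'\cdots \gamma_N'}&\equiv 2\tfrac{N}{N+1}R_{\alpha(\gamma_1'\gamma_2'|\beta'|,\gamma_3'\cdots \gamma_N')\gamma_1\cdots \gamma_M} && M\ge 0,\ N\ge 2\\ g_{\alpha'\beta'}&\equiv h_{\alpha'\beta'}\\ g_{\alpha'\beta',\gamma_1\cdots \gamma_M}&\equiv 0 && M\ge 1\\ g_{\alpha'\beta',\gamma_1\cdots \gamma_M\gamma'}&\equiv 0 && M\ge 0\\ g_{\alpha'\beta',\gamma_1\cdots \gamma_M\gamma_1'\cdots \gamma_N'}&\equiv 2\tfrac{N-1}{N+1}R_{\alpha'(\gamma_1'\gamma_2'|\beta'|,\gamma_3'\cdots \gamma_N')\gamma_1\cdots \gamma_M} && M\ge 0,\ N\ge 2. \end{aligned} $$ -/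

import Mathlib

open scoped Manifold ContDiff Topology

noncomputable section

namespace SubmanifoldCoords

/-! ### Pseudo-Riemannian geometry in a coordinate patch

A metric in coordinates `y : ι → ℝ` is given by its matrix of components `G y i j`. -/

section Coordinates

variable {ι : Type} [Fintype ι] [DecidableEq ι]

/-- The partial derivative `∂f/∂yⁱ` at `y`. -/
def pd (f : (ι → ℝ) → ℝ) (i : ι) (y : ι → ℝ) : ℝ :=
  fderiv ℝ f y (Pi.single i 1)

/-- The iterated partial derivative `∂^m f/∂y^{c₀} ⋯ ∂y^{c_{m-1}}` at `y`. -/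
def iterPd {m : ℕ} (f : (ι → ℝ) → ℝ) (c : Fin m → ι) (y : ι → ℝ) : ℝ :=
  iteratedFDeriv ℝ m f y (fun s => Pi.single (c s) 1)

/-- The Christoffel symbols
`Γⁱ_{jm} = ½ Gⁱˢ (∂_j G_{ms} + ∂_m G_{js} - ∂_s G_{jm})` of the Levi-Civita connection. -/
def christoffel (G : (ι → ℝ) → Matrix ι ι ℝ) (i j m : ι) (y : ι → ℝ) : ℝ :=
  (1 / 2) * ∑ s, (G y)⁻¹ i s *
    (pd (fun w => G w m s) j y + pd (fun w => G w j s) m y - pd (fun w => G w j m) s y)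

/-- The curvature components `Rⁱ_{jab} = dyⁱ(R(∂_a, ∂_b) ∂_j)`, where
`R(X, Y) = ∇_X ∇_Y - ∇_Y ∇_X - ∇_{[X, Y]}`. -/
def curvatureUp (G : (ι → ℝ) → Matrix ι ι ℝ) (i j a b : ι) (y : ι → ℝ) : ℝ :=
  pd (christoffel G i b j) a y - pd (christoffel G i a j) b y +
    ∑ s, (christoffel G i a s y * christoffel G s b j y -
      christoffel G i b s y * christoffel G s a j y)

/-- The components `R_{a₀a₁a₂a₃} = G_{a₀s} Rˢ_{a₁a₂a₃}` of the covariant curvature tensor. -/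
def curvature (G : (ι → ℝ) → Matrix ι ι ℝ) (a : Fin 4 → ι) (y : ι → ℝ) : ℝ :=
  ∑ s, G y (a 0) s * curvatureUp G s (a 1) (a 2) (a 3) y

/-- The components `R_{a₀a₁a₂a₃,c₀⋯c_{m-1}}` of the `m`-th covariant derivative `∇^m Rm`
(the index of the last differentiation comes last). -/
def nablaCurvature (G : (ι → ℝ) → Matrix ι ι ℝ) :
    (m : ℕ) → (Fin 4 → ι) → (Fin m → ι) → (ι → ℝ) → ℝ
  | 0, a, _, y => curvature G a y
  | m + 1, a, c, y =>
      pd (nablaCurvature G m a (fun s => c s.castSucc)) (c (Fin.last m)) y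
      - ∑ s : Fin 4, ∑ p, christoffel G p (c (Fin.last m)) (a s) y *
          nablaCurvature G m (Function.update a s p) (fun t => c t.castSucc) y
      - ∑ s : Fin m, ∑ p, christoffel G p (c (Fin.last m)) (c s.castSucc) y *
          nablaCurvature G m a (Function.update (fun t => c t.castSucc) s p) y

/-- The curve `c` satisfies the geodesic equation of the metric `G` at all times `t ∈ J`. -/
def IsGeodesicOn (G : (ι → ℝ) → Matrix ι ι ℝ) (c : ℝ → ι → ℝ) (J : Set ℝ) : Prop :=
  ContDiff ℝ 2 c ∧ ∀ t ∈ J, ∀ i,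
    iteratedDeriv 2 (fun r => c r i) t +
      ∑ j, ∑ m, christoffel G i j m (c t) * deriv (fun r => c r j) t *
        deriv (fun r => c r m) t = 0

end Coordinates

/-! ### The submanifold `{u = 0}` in coordinates `(x, u)`

An index is either tangential, `Sum.inl α`, or normal, `Sum.inr α'`; a point of the coordinate
space is `Sum.elim x u`. The definitions below, except `inducedMetric`, give the components of
the named objects when the fields `∂_{α'}` are normal to `{u = 0}`, as they are in the coordinate
systems considered here. -/

section Submanifold

variable {k l : ℕ}

/-- The components at `(x, 0)` of the metric induced on `{u = 0}`. -/
def inducedMetric (G : (Fin k ⊕ Fin l → ℝ) → Matrix (Fin k ⊕ Fin l) (Fin k ⊕ Fin l) ℝ)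
    (x : Fin k → ℝ) : Matrix (Fin k) (Fin k) ℝ :=
  fun α β => G (Sum.elim x 0) (Sum.inl α) (Sum.inl β)

/-- The connection coefficients at `(x, 0)` of the induced connection of the normal bundle:
the normal part of `∇_{∂_α} ∂_{β'}` is `∑ δ', normalConnection G δ' α β' x • ∂_{δ'}`. -/
def normalConnection (G : (Fin k ⊕ Fin l → ℝ) → Matrix (Fin k ⊕ Fin l) (Fin k ⊕ Fin l) ℝ)
    (δ' : Fin l) (α : Fin k) (β' : Fin l) (x : Fin k → ℝ) : ℝ :=
  christoffel G (Sum.inr δ') (Sum.inl α) (Sum.inr β') (Sum.elim x 0)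

/-- The components `L_{a₀a₁ν} = g(∇_{∂_{a₀}} ∂_{a₁}, ∂_ν)` at `(x, 0)` of the second fundamental
form `L(X, Y) = (∇_X Y)^⊥`, with its normal index `ν` lowered. -/
def secondFundamentalForm
    (G : (Fin k ⊕ Fin l → ℝ) → Matrix (Fin k ⊕ Fin l) (Fin k ⊕ Fin l) ℝ)
    (a : Fin 2 → Fin k) (ν : Fin l) (x : Fin k → ℝ) : ℝ :=
  ∑ s, G (Sum.elim x 0) s (Sum.inr ν) *
    christoffel G s (Sum.inl (a 0)) (Sum.inl (a 1)) (Sum.elim x 0)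

/-- The components `L_{a₀a₁ν,c₀⋯c_{m-1}}` at `(x, 0)` of the `m`-th covariant derivative of the
second fundamental form with respect to the induced connections: the Levi-Civita connection of the
induced metric in the tangential slots, the normal connection in the slot `ν`. -/
def nablaSecondFundamentalForm
    (G : (Fin k ⊕ Fin l → ℝ) → Matrix (Fin k ⊕ Fin l) (Fin k ⊕ Fin l) ℝ) :
    (m : ℕ) → (Fin 2 → Fin k) → Fin l → (Fin m → Fin k) → (Fin k → ℝ) → ℝ
  | 0, a, ν, _, x => secondFundamentalForm G a ν x
  | m + 1, a, ν, c, x =>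
      pd (nablaSecondFundamentalForm G m a ν (fun s => c s.castSucc)) (c (Fin.last m)) x
      - ∑ s : Fin 2, ∑ p, christoffel (inducedMetric G) p (c (Fin.last m)) (a s) x *
          nablaSecondFundamentalForm G m (Function.update a s p) ν (fun t => c t.castSucc) x
      - ∑ s : Fin m, ∑ p, christoffel (inducedMetric G) p (c (Fin.last m)) (c s.castSucc) x *
          nablaSecondFundamentalForm G m a ν (Function.update (fun t => c t.castSucc) s p) x
      - ∑ δ', normalConnection G δ' (c (Fin.last m)) ν x *
          nablaSecondFundamentalForm G m a δ' (fun t => c t.castSucc) x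

/-- Names for the components of all covariant derivatives of the curvature tensor and of the second
fundamental form; the variables of universal polynomials. -/
inductive JetVar (k l : ℕ) : Type
  | curv (m : ℕ) (a : Fin 4 → Fin k ⊕ Fin l) (c : Fin m → Fin k ⊕ Fin l) : JetVar k l
  | sff (m : ℕ) (a : Fin 2 → Fin k) (ν : Fin l) (c : Fin m → Fin k) : JetVar k l

/-- The values of these components at the origin of the coordinates. -/
def jetVal (G : (Fin k ⊕ Fin l → ℝ) → Matrix (Fin k ⊕ Fin l) (Fin k ⊕ Fin l) ℝ) :
    JetVar k l → ℝ
  | .curv m a c => nablaCurvature G m a c 0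
  | .sff m a ν c => nablaSecondFundamentalForm G m a ν c 0

/-- The symmetrization `R_{i(c₀c₁|j|,c₂⋯c_{N+1})d₀⋯d_{r-1}}` over the indices `c`, at the origin. -/
def symCurvature (G : (Fin k ⊕ Fin l → ℝ) → Matrix (Fin k ⊕ Fin l) (Fin k ⊕ Fin l) ℝ)
    (i j : Fin k ⊕ Fin l) {N r : ℕ} (c : Fin (N + 2) → Fin k ⊕ Fin l)
    (d : Fin r → Fin k ⊕ Fin l) : ℝ :=
  (1 / ((N + 2).factorial : ℝ)) * ∑ σ : Equiv.Perm (Fin (N + 2)),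
    nablaCurvature G (N + r) ![i, c (σ 0), c (σ 1), j]
      (Fin.append (fun s : Fin N => c (σ s.succ.succ)) d) 0

/-- The symmetrization `R_{ijp(c₀,c₁⋯c_M)}` over the indices `c`, at the origin. -/
def symCurvature' (G : (Fin k ⊕ Fin l → ℝ) → Matrix (Fin k ⊕ Fin l) (Fin k ⊕ Fin l) ℝ)
    (i j p : Fin k ⊕ Fin l) {M : ℕ} (c : Fin (M + 1) → Fin k ⊕ Fin l) : ℝ :=
  (1 / ((M + 1).factorial : ℝ)) * ∑ σ : Equiv.Perm (Fin (M + 1)),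
    nablaCurvature G M ![i, j, p, c (σ 0)] (fun s : Fin M => c (σ s.succ)) 0

end Submanifold

/-! ### Manifolds -/

/-- A smooth pseudo-Riemannian metric on a smooth `n`-manifold: a smooth field of nondegenerate
symmetric bilinear forms on the tangent spaces. -/
structure PseudoRiemannianMetric (n : ℕ) (M : Type*) [TopologicalSpace M]
    [ChartedSpace (EuclideanSpace ℝ (Fin n)) M] [IsManifold (𝓡 n) ∞ M] where
  /-- The bilinear form on the tangent space at a point. -/
  val (q : M) : TangentSpace (𝓡 n) q →L[ℝ] TangentSpace (𝓡 n) q →L[ℝ] ℝ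
  symm (q : M) (v w : TangentSpace (𝓡 n) q) : val q v w = val q w v
  nondegenerate (q : M) (v : TangentSpace (𝓡 n) q) : (∀ w, val q v w = 0) → v = 0
  contMDiff : ContMDiff (𝓡 n)
    ((𝓡 n).prod 𝓘(ℝ, EuclideanSpace ℝ (Fin n) →L[ℝ] EuclideanSpace ℝ (Fin n) →L[ℝ] ℝ)) ∞
    (fun q => Bundle.TotalSpace.mk'
      (EuclideanSpace ℝ (Fin n) →L[ℝ] EuclideanSpace ℝ (Fin n) →L[ℝ] ℝ) q (val q))

section Charts

variable {k l : ℕ} {M : Type*} [TopologicalSpace M]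
  [ChartedSpace (EuclideanSpace ℝ (Fin (k + l))) M] [IsManifold (𝓡 (k + l)) ∞ M]

/-- The coordinate vector field `∂_i` of the coordinate system `z`, at the point with
coordinates `y`. -/
def coordVector (z : OpenPartialHomeomorph M (Fin k ⊕ Fin l → ℝ)) (i : Fin k ⊕ Fin l)
    (y : Fin k ⊕ Fin l → ℝ) : TangentSpace (𝓡 (k + l)) (z.symm y) :=
  mfderiv 𝓘(ℝ, Fin k ⊕ Fin l → ℝ) (𝓡 (k + l)) z.symm y
    (Pi.single i 1 : Fin k ⊕ Fin l → ℝ)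

/-- The components `g_{ij} = g(∂_i, ∂_j)` of the metric in the coordinate system `z`, as functions
of the coordinates. -/
def metricCoeff (g : PseudoRiemannianMetric (k + l) M)
    (z : OpenPartialHomeomorph M (Fin k ⊕ Fin l → ℝ)) (y : Fin k ⊕ Fin l → ℝ) :
    Matrix (Fin k ⊕ Fin l) (Fin k ⊕ Fin l) ℝ :=
  fun i j => g.val (z.symm y) (coordVector z i y) (coordVector z j y)

/-- `z = (x, u)` is a submanifold geodesic normal coordinate system of `S ⊆ M` at `p ∈ S`, whose
frame `∂_α(p)`, `∂_{α'}(p)` at `p` has the inner products prescribed by the forms `hT`, `hN`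
(and `∂_α(p) ⟂ ∂_{α'}(p)`). By `adapted`, `S` is near `p` an embedded `k`-dimensional
submanifold. -/
structure IsSubmanifoldNormalCoords (g : PseudoRiemannianMetric (k + l) M) (S : Set M) (p : M)
    (hT : Matrix (Fin k) (Fin k) ℝ) (hN : Matrix (Fin l) (Fin l) ℝ)
    (z : OpenPartialHomeomorph M (Fin k ⊕ Fin l → ℝ)) : Prop where
  /-- `z` is a smooth coordinate system. -/
  smooth : ContMDiffOn (𝓡 (k + l)) 𝓘(ℝ, Fin k ⊕ Fin l → ℝ) ∞ z z.source
  smooth_symm : ContMDiffOn 𝓘(ℝ, Fin k ⊕ Fin l → ℝ) (𝓡 (k + l)) ∞ z.symm z.target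
  /-- `p` has coordinates `(0, 0)`. -/
  mem_source : p ∈ z.source
  map_base : z p = 0
  /-- `S = {u = 0}` in the domain of the coordinates. -/
  adapted : ∀ q ∈ z.source, q ∈ S ↔ ∀ a, z q (Sum.inr a) = 0
  /-- The coordinate frame at `p` has the prescribed inner products. -/
  frame : metricCoeff g z 0 = Matrix.fromBlocks hT 0 0 hN
  /-- The curves `t ↦ t x` in `S`, for `x` near `0`, are geodesics of the induced metric. -/
  radial_geodesic : ∀ᶠ x in 𝓝 (0 : Fin k → ℝ),
    IsGeodesicOn (inducedMetric (metricCoeff g z)) (fun t => t • x) (Set.Icc 0 1)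
  /-- The `∂_{α'}` are normal to `S` along `S`. -/
  normal : ∀ᶠ x in 𝓝 (0 : Fin k → ℝ), ∀ α α',
    metricCoeff g z (Sum.elim x 0) (Sum.inl α) (Sum.inr α') = 0
  /-- The `∂_{β'}` are parallel for the normal connection along the curves `t ↦ t x` in `S`. -/
  normal_parallel : ∀ᶠ x in 𝓝 (0 : Fin k → ℝ), ∀ t ∈ Set.Icc (0 : ℝ) 1, ∀ β' δ',
    ∑ α, x α * normalConnection (metricCoeff g z) δ' α β' (t • x) = 0
  /-- The curves `t ↦ (x, t u)`, for `(x, u)` near `(0, 0)`, are geodesics of `g`. -/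
  normal_geodesic : ∀ᶠ y in 𝓝 (0 : Fin k ⊕ Fin l → ℝ),
    IsGeodesicOn (metricCoeff g z)
      (fun t => Sum.elim (fun α => y (Sum.inl α)) (fun α' => t * y (Sum.inr α'))) (Set.Icc 0 1)

end Charts

end SubmanifoldCoords

end

open SubmanifoldCoords

/-! Each coordinate condition says that a smooth function vanishes near the origin: `x^a x^b
Γ_{p,ab}(x)` for the induced metric, `x^a Γ_{γ',aβ'}(x,0)`, `u^a u^b Γ_{p,ab}(x,u)`, and
`g_{αβ'}(x,0)`. Their Taylor coefficients give linear relations between the partial derivatives of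
the metric at the base point. These amount to the Gauss lemma in `Σ` and in the normal directions
(`sum₁_eq_zero_of_two_le`), together with the vanishing or antisymmetry of the derivatives with at
most one normal index.

To first order, `R_{ijab}` is a combination of four second derivatives of the metric. Symmetrizing
over the derivative indices and applying the Gauss relations collapses this combination to a
multiple of one metric derivative. The multiple is nonzero for the index types that occur, so the
relation can be solved for that derivative, and its reciprocal gives the stated coefficient
(`sum₂_linearized_curvature` and the `sum₂_curvatureClass_*` lemmas). The tangential components with
exactly one normal derivative come instead from `L_{αβγ'} = -½ ∂_{γ'} g_{αβ}` on `Σ`.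

Universality is obtained by treating all admissible metrics at once. A quantity is a function on the
set of these metrics; `polyOrder d` consists of those given by one polynomial in the jet variables
with all terms of degree at least `d`, and `≡` is equality in the quotient by `polyOrder 2`. The
metric at the origin is the fixed `h`, so its inverse contributes only constants there. If the first
derivatives of the metric have all jets up to order `s` in `polyOrder 1`, then so do the Christoffel
symbols. The quadratic part of the curvature, and the difference between covariant and partial
derivatives, then fall into `polyOrder 2`. The jets of `R` and `L` up to order `s + 1` therefore lie
in `polyOrder 1`, and solving for the metric derivatives raises `s` by one
(`pd_metric_mem_jetOrder`). After this induction every linearized identity holds modulo `polyOrder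
2` at all orders.

Symmetrizations are handled as sums over removed elements of a multiset: a product `x^a f` has
`c`-th derivative `count a c` times the `(c - a)`-th derivative of `f`, so Taylor coefficients and
sums over permutations take the same form. -/

namespace SubmanifoldCoords

/-! ### Partial derivatives and jets at the origin -/

section Jets

set_option linter.unusedSectionVars false

open Filter

variable {κ : Type} [Fintype κ] [DecidableEq κ]

/-- Smoothness at the origin of coordinate space. -/
abbrev SmoothAt (f : (κ → ℝ) → ℝ) : Prop := ContDiffAt ℝ ∞ f 0

theorem SmoothAt.eventually {f : (κ → ℝ) → ℝ} (hf : SmoothAt f) :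
    ∀ᶠ y in 𝓝 (0 : κ → ℝ), ContDiffAt ℝ 2 f y :=
  (hf.of_le (m := ((2 : ℕ∞) : ℕ∞ω)) (WithTop.coe_le_coe.2 le_top)).eventually (by decide)

theorem SmoothAt.eventually_differentiableAt {f : (κ → ℝ) → ℝ} (hf : SmoothAt f) :
    ∀ᶠ y in 𝓝 (0 : κ → ℝ), DifferentiableAt ℝ f y :=
  hf.eventually.mono fun _ h => h.differentiableAt two_ne_zero

theorem SmoothAt.add {f g : (κ → ℝ) → ℝ} (hf : SmoothAt f) (hg : SmoothAt g) :
    SmoothAt (f + g) := ContDiffAt.add hf hg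

theorem SmoothAt.sub {f g : (κ → ℝ) → ℝ} (hf : SmoothAt f) (hg : SmoothAt g) :
    SmoothAt (f - g) := ContDiffAt.sub hf hg

theorem SmoothAt.mul {f g : (κ → ℝ) → ℝ} (hf : SmoothAt f) (hg : SmoothAt g) :
    SmoothAt (f * g) := ContDiffAt.mul hf hg

theorem SmoothAt.smul (r : ℝ) {f : (κ → ℝ) → ℝ} (hf : SmoothAt f) : SmoothAt (r • f) :=
  ContDiffAt.const_smul r hf

theorem SmoothAt.const (r : ℝ) : SmoothAt (fun _ : κ → ℝ => r) := contDiffAt_const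

theorem SmoothAt.zero : SmoothAt (0 : (κ → ℝ) → ℝ) := contDiffAt_const

theorem SmoothAt.inv {f : (κ → ℝ) → ℝ} (hf : SmoothAt f) (h0 : f 0 ≠ 0) : SmoothAt f⁻¹ :=
  ContDiffAt.inv hf h0

theorem SmoothAt.congr {f g : (κ → ℝ) → ℝ} (hf : SmoothAt f) (h : g =ᶠ[𝓝 0] f) : SmoothAt g :=
  ContDiffAt.congr_of_eventuallyEq hf h

theorem SmoothAt.pd {f : (κ → ℝ) → ℝ} (hf : SmoothAt f) (i : κ) : SmoothAt (pd f i) :=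
  (hf.fderiv_right (m := ∞) le_rfl).clm_apply contDiffAt_const

theorem pd_congr {f g : (κ → ℝ) → ℝ} (h : f =ᶠ[𝓝 0] g) (i : κ) : pd f i =ᶠ[𝓝 0] pd g i :=
  (h.fderiv (𝕜 := ℝ)).mono fun y hy => by simp only [pd, hy]

theorem pd_add {f g : (κ → ℝ) → ℝ} (hf : SmoothAt f) (hg : SmoothAt g) (i : κ) :
    pd (f + g) i =ᶠ[𝓝 0] pd f i + pd g i := by
  filter_upwards [hf.eventually_differentiableAt, hg.eventually_differentiableAt] with y h₁ h₂
  simp [pd, fderiv_add h₁ h₂]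

theorem pd_smul (r : ℝ) {f : (κ → ℝ) → ℝ} (hf : SmoothAt f) (i : κ) :
    pd (r • f) i =ᶠ[𝓝 0] r • pd f i := by
  filter_upwards [hf.eventually_differentiableAt] with y h₁
  simp [pd, fderiv_const_smul h₁]

theorem pd_mul {f g : (κ → ℝ) → ℝ} (hf : SmoothAt f) (hg : SmoothAt g) (i : κ) :
    pd (f * g) i =ᶠ[𝓝 0] pd f i * g + f * pd g i := by
  filter_upwards [hf.eventually_differentiableAt, hg.eventually_differentiableAt] with y h₁ h₂
  simp [pd, fderiv_mul h₁ h₂]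
  ring

theorem pd_inv {f : (κ → ℝ) → ℝ} (hf : SmoothAt f) (h0 : f 0 ≠ 0) (i : κ) :
    pd f⁻¹ i =ᶠ[𝓝 0] (-1 : ℝ) • (pd f i * (f⁻¹ * f⁻¹)) := by
  filter_upwards [hf.eventually_differentiableAt, hf.continuousAt.eventually_ne h0] with y h₁ h₂
  have := ((hasDerivAt_inv h₂).comp_hasFDerivAt y h₁.hasFDerivAt).fderiv
  simp only [pd]
  rw [show (f⁻¹ : (κ → ℝ) → ℝ) = Inv.inv ∘ f from rfl, this]
  simp [pd]
  field_simp

theorem pd_const (r : ℝ) (i : κ) : pd (fun _ : κ → ℝ => r) i = 0 := by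
  ext y; simp [pd]

theorem pd_coord (i j : κ) : pd (fun y : κ → ℝ => y i) j = fun _ => if i = j then 1 else 0 := by
  ext y
  have : HasFDerivAt (fun y : κ → ℝ => y i) (ContinuousLinearMap.proj (R := ℝ) i) y :=
    (ContinuousLinearMap.proj (R := ℝ) (φ := fun _ : κ => ℝ) i).hasFDerivAt
  simp [pd, this.fderiv, Pi.single_apply]

theorem pd_comm {f : (κ → ℝ) → ℝ} (hf : SmoothAt f) (i j : κ) :
    pd (pd f i) j =ᶠ[𝓝 0] pd (pd f j) i := by
  have key : ∀ᶠ y in 𝓝 (0 : κ → ℝ), ∀ a b : κ, pd (pd f a) b y =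
      fderiv ℝ (fderiv ℝ f) y (Pi.single b 1) (Pi.single a 1) := by
    filter_upwards [hf.eventually] with y hy a b
    have h : DifferentiableAt ℝ (fderiv ℝ f) y :=
      (hy.fderiv_right (m := 1) (by norm_num)).differentiableAt one_ne_zero
    have := h.hasFDerivAt.clm_apply (hasFDerivAt_const (Pi.single a 1 : κ → ℝ) y)
    rw [pd, show pd f a = fun y => fderiv ℝ f y (Pi.single a 1) from rfl, this.fderiv]
    simp
  filter_upwards [key, hf.eventually] with y hy h2
  rw [hy, hy]
  exact h2.isSymmSndFDerivAt (by simp) _ _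

/-- Iterated partial derivatives at the origin along a list of indices. -/
noncomputable def jetList : ((κ → ℝ) → ℝ) → List κ → ℝ
  | f, [] => f 0
  | f, i :: s => jetList (pd f i) s

theorem jetList_congr {f g : (κ → ℝ) → ℝ} (h : f =ᶠ[𝓝 0] g) (s : List κ) :
    jetList f s = jetList g s := by
  induction s generalizing f g with
  | nil => exact h.eq_of_nhds
  | cons i s ih => exact ih (pd_congr h i)

/-- Permutations are generated by adjacent swaps, and each swap is Schwarz's theorem near the
origin. This is what makes multisets legitimate derivative indices. -/
theorem jetList_perm {s t : List κ} (h : s.Perm t) {f : (κ → ℝ) → ℝ} (hf : SmoothAt f) :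
    jetList f s = jetList f t := by
  induction h generalizing f with
  | nil => rfl
  | cons i _ ih => exact ih (hf.pd i)
  | swap i j s => exact jetList_congr (pd_comm hf j i) s
  | trans _ _ ih₁ ih₂ => exact (ih₁ hf).trans (ih₂ hf)

/-- The partial derivative at the origin along a multiset of indices. -/
noncomputable def jet (f : (κ → ℝ) → ℝ) (c : Multiset κ) : ℝ := jetList f c.toList

theorem jet_coe {f : (κ → ℝ) → ℝ} (hf : SmoothAt f) (s : List κ) :
    jet f (s : Multiset κ) = jetList f s :=
  jetList_perm (Multiset.coe_eq_coe.1 (Multiset.coe_toList _)) hf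

theorem jet_zero (f : (κ → ℝ) → ℝ) : jet f 0 = f 0 := by simp [jet, jetList]

theorem jet_cons {f : (κ → ℝ) → ℝ} (hf : SmoothAt f) (i : κ) (c : Multiset κ) :
    jet f (i ::ₘ c) = jet (pd f i) c := by
  induction c using Quotient.inductionOn with
  | h s => 
    change jet f ((i :: s : List κ) : Multiset κ) = jet (pd f i) (s : Multiset κ)
    rw [jet_coe hf, jet_coe (hf.pd i)]; rfl

theorem jet_congr {f g : (κ → ℝ) → ℝ} (h : f =ᶠ[𝓝 0] g) (c : Multiset κ) : jet f c = jet g c :=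
  jetList_congr h _

theorem jet_add {f g : (κ → ℝ) → ℝ} (hf : SmoothAt f) (hg : SmoothAt g) (c : Multiset κ) :
    jet (f + g) c = jet f c + jet g c := by
  induction c using Multiset.induction generalizing f g with
  | empty => simp [jet_zero]
  | cons i c ih =>
    rw [jet_cons (hf.add hg), jet_cons hf, jet_cons hg, ← ih (hf.pd i) (hg.pd i)]
    exact jet_congr (pd_add hf hg i) c

theorem jet_smul (r : ℝ) {f : (κ → ℝ) → ℝ} (hf : SmoothAt f) (c : Multiset κ) :
    jet (r • f) c = r * jet f c := by
  induction c using Multiset.induction generalizing f with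
  | empty => simp [jet_zero]
  | cons i c ih =>
    rw [jet_cons (SmoothAt.smul r hf), jet_cons hf, ← ih (hf.pd i)]
    exact jet_congr (pd_smul r hf i) c

theorem jet_sub {f g : (κ → ℝ) → ℝ} (hf : SmoothAt f) (hg : SmoothAt g) (c : Multiset κ) :
    jet (f - g) c = jet f c - jet g c := by
  have : f - g = f + (-1 : ℝ) • g := by ext; simp [sub_eq_add_neg]
  rw [this, jet_add hf (SmoothAt.smul (-1 : ℝ) hg), jet_smul _ hg]
  ring

theorem jet_const (r : ℝ) (i : κ) (c : Multiset κ) :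
    jet (fun _ : κ → ℝ => r) (i ::ₘ c) = 0 := by
  have h0 : ∀ c : Multiset κ, jet (0 : (κ → ℝ) → ℝ) c = 0 := fun c => by
    have := jet_smul (κ := κ) 0 (f := 0) SmoothAt.zero c
    simpa using this
  rw [jet_cons (SmoothAt.const r), pd_const, h0]

theorem jet_fun_zero (c : Multiset κ) : jet (0 : (κ → ℝ) → ℝ) c = 0 := by
  have := jet_smul (κ := κ) 0 (f := 0) SmoothAt.zero c
  simpa using this

theorem SmoothAt.finsetSum {σ : Type*} {s : Finset σ} {f : σ → (κ → ℝ) → ℝ}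
    (hf : ∀ a, SmoothAt (f a)) : SmoothAt (∑ a ∈ s, f a) := by
  classical
  induction s using Finset.induction_on with
  | empty => exact SmoothAt.zero
  | insert a s ha ih => rw [Finset.sum_insert ha]; exact (hf a).add ih

theorem jet_sum {σ : Type*} (s : Finset σ) {f : σ → (κ → ℝ) → ℝ} (hf : ∀ a, SmoothAt (f a))
    (c : Multiset κ) : jet (∑ a ∈ s, f a) c = ∑ a ∈ s, jet (f a) c := by
  classical
  induction s using Finset.induction_on with
  | empty => simpa using jet_fun_zero c
  | insert a s ha ih =>
    rw [Finset.sum_insert ha, Finset.sum_insert ha, jet_add (hf a) (SmoothAt.finsetSum hf), ih]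

theorem smoothAt_coord (i : κ) : SmoothAt (fun y : κ → ℝ => y i) := contDiffAt_apply ℝ ℝ i 0

/-- Leibniz rule: at the origin a term survives only if exactly one derivative, in direction `i`,
hits the coordinate. There are `count i c` choices for it. -/
theorem jet_coord_mul {f : (κ → ℝ) → ℝ} (hf : SmoothAt f) (i : κ) (c : Multiset κ) :
    jet ((fun y => y i) * f) c = c.count i * jet f (c.erase i) := by
  induction c using Multiset.induction generalizing f with
  | empty => simp [jet_zero]
  | cons j c ih =>
    have hx := smoothAt_coord i
    rw [jet_cons (hx.mul hf), jet_congr (pd_mul hx hf j),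
      jet_add ((hx.pd j).mul hf) (hx.mul (hf.pd j)), ih (hf.pd j), pd_coord]
    by_cases h : i = j
    · subst h
      have h1 : ((fun _ : κ → ℝ => if i = i then (1 : ℝ) else 0) * f) = f := by ext; simp
      rw [h1, Multiset.count_cons_self, Multiset.erase_cons_head]
      by_cases hi : i ∈ c
      · rw [← jet_cons hf, Multiset.cons_erase hi]; push_cast; ring
      · simp [Multiset.count_eq_zero.2 hi]
    · have h1 : ((fun _ : κ → ℝ => if i = j then (1 : ℝ) else 0) * f) = 0 := by ext; simp [h]
      rw [h1, jet_fun_zero, Multiset.count_cons_of_ne h, zero_add, ← jet_cons hf,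
        Multiset.erase_cons_tail _ (Ne.symm h)]

/-- Jets of `∑ a, y (e a) f_a(y)`. -/
theorem jet_sum_coord_mul {ν : Type} [Fintype ν] [DecidableEq ν] (e : ν ↪ κ)
    {f : ν → (κ → ℝ) → ℝ} (hf : ∀ a, SmoothAt (f a)) (T : Multiset κ)
    (hT : ∀ a, e a ∉ T) (U : Multiset ν) :
    jet (∑ a, (fun y => y (e a)) * f a) (T + U.map e) =
      (U.map fun a => jet (f a) (T + (U.erase a).map e)).sum := by
  rw [jet_sum _ fun a => (smoothAt_coord _).mul (hf a)]
  simp_rw [jet_coord_mul (hf _)]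
  rw [Finset.sum_multiset_map_count, ← Finset.sum_subset (Finset.subset_univ U.toFinset)]
  · refine Finset.sum_congr rfl fun a ha => ?_
    rw [Multiset.count_add, Multiset.count_eq_zero.2 (hT a), zero_add,
      Multiset.count_map_eq_count' _ _ e.injective, Multiset.erase_add_right_neg _ (hT a),
      Multiset.map_erase _ e.injective, nsmul_eq_mul]
  · intro a _ ha
    rw [Multiset.count_add, Multiset.count_eq_zero.2 (hT a), zero_add,
      Multiset.count_map_eq_count' _ _ e.injective,
      Multiset.count_eq_zero.2 (by simpa using ha)]
    simp

/-- The multiset of values of a tuple. -/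
def mset {α : Type*} {m : ℕ} (c : Fin m → α) : Multiset α := (List.ofFn c : Multiset α)

theorem mset_snoc {α : Type*} {m : ℕ} (c : Fin (m + 1) → α) :
    mset c = c (Fin.last m) ::ₘ mset (fun s => c s.castSucc) := by
  rw [mset, mset, List.ofFn_succ', List.concat_eq_append, ← Multiset.coe_add, add_comm]
  rfl

theorem iterPd_eq_jet {m : ℕ} {f : (κ → ℝ) → ℝ} (hf : SmoothAt f) (c : Fin m → κ) :
    iterPd f c 0 = jet f (mset c) := by
  induction m generalizing f with
  | zero => simp [iterPd, mset, jet_zero]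
  | succ m ih =>
    rw [mset_snoc, jet_cons hf, ← ih (hf.pd _), iterPd, iteratedFDeriv_succ_apply_right, iterPd]
    have h2 : ContDiffAt ℝ ∞ (fderiv ℝ f) 0 := hf.fderiv_right (m := ∞) le_rfl
    have h3 : pd f (c (Fin.last m)) =
        (ContinuousLinearMap.apply ℝ ℝ (Pi.single (c (Fin.last m)) 1 : κ → ℝ)) ∘ fderiv ℝ f := rfl
    rw [h3, ContinuousLinearMap.iteratedFDeriv_comp_left _ h2 (by exact_mod_cast le_top)]
    rfl

theorem pd_comp {κ' : Type} [Fintype κ'] [DecidableEq κ'] (L : (κ' → ℝ) →L[ℝ] (κ → ℝ)) (e : κ' → κ)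
    (hL : ∀ i, L (Pi.single i 1) = Pi.single (e i) 1) {f : (κ → ℝ) → ℝ} (hf : SmoothAt f) (i : κ') :
    pd (f ∘ L) i =ᶠ[𝓝 0] pd f (e i) ∘ L := by
  have h : Tendsto L (𝓝 0) (𝓝 0) := by simpa using L.continuous.tendsto 0
  filter_upwards [h.eventually hf.eventually_differentiableAt] with y hy
  have := (hy.hasFDerivAt.comp y L.hasFDerivAt).fderiv
  rw [pd, this]
  simp [hL, pd]

theorem SmoothAt.comp_clm {κ' : Type} [Fintype κ'] (L : (κ' → ℝ) →L[ℝ] (κ → ℝ))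
    {f : (κ → ℝ) → ℝ} (hf : SmoothAt f) : SmoothAt (f ∘ L) :=
  ContDiffAt.comp _ (by simpa using hf) L.contDiff.contDiffAt

/-- Jets of the restriction to a coordinate subspace. -/
theorem jet_comp {κ' : Type} [Fintype κ'] [DecidableEq κ'] (L : (κ' → ℝ) →L[ℝ] (κ → ℝ)) (e : κ' → κ)
    (hL : ∀ i, L (Pi.single i 1) = Pi.single (e i) 1) {f : (κ → ℝ) → ℝ} (hf : SmoothAt f)
    (c : Multiset κ') : jet (f ∘ L) c = jet f (c.map e) := by
  induction c using Multiset.induction generalizing f with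
  | empty => simp [jet_zero]
  | cons i c ih =>
    rw [Multiset.map_cons, jet_cons (hf.comp_clm L), jet_cons hf, ← ih (hf.pd _)]
    exact jet_congr (pd_comp L e hL hf i) c

end Jets

/-! ### Sums over multisets with removed elements -/

section MultisetSums

set_option linter.unusedSectionVars false

variable {ι : Type*} [DecidableEq ι] {W : Type*} [AddCommGroup W] [Module ℝ W]

/-- The sum of `φ a (U - a)` over `a ∈ U`. -/
def sum₁ (φ : ι → Multiset ι → W) (U : Multiset ι) : W := (U.map fun a => φ a (U.erase a)).sum

/-- The sum of `φ a b (U - a - b)` over the ordered pairs of elements `a, b` of `U`. -/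
def sum₂ (φ : ι → ι → Multiset ι → W) (U : Multiset ι) : W := sum₁ (fun a => sum₁ (φ a)) U

theorem sum₁_congr {φ ψ : ι → Multiset ι → W} {U : Multiset ι}
    (h : ∀ a V, a ::ₘ V = U → φ a V = ψ a V) : sum₁ φ U = sum₁ ψ U :=
  congrArg _ (Multiset.map_congr rfl fun a ha => h a _ (Multiset.cons_erase ha))

theorem sum₂_congr {φ ψ : ι → ι → Multiset ι → W} {U : Multiset ι}
    (h : ∀ a b V, a ::ₘ b ::ₘ V = U → φ a b V = ψ a b V) : sum₂ φ U = sum₂ ψ U :=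
  sum₁_congr fun a V hV => sum₁_congr fun b V' hV' => h a b V' (by rw [hV', hV])

@[simp] theorem sum₁_empty (φ : ι → Multiset ι → W) : sum₁ φ 0 = 0 := by simp [sum₁]

theorem sum₁_cons (φ : ι → Multiset ι → W) (a : ι) (U : Multiset ι) :
    sum₁ φ (a ::ₘ U) = φ a U + sum₁ (fun b V => φ b (a ::ₘ V)) U := by
  rw [sum₁, Multiset.map_cons, Multiset.sum_cons, Multiset.erase_cons_head, sum₁]
  congr 2
  exact Multiset.map_congr rfl fun b hb => by rw [Multiset.erase_cons_tail_of_mem hb]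

theorem sum₁_add (φ ψ : ι → Multiset ι → W) (U : Multiset ι) :
    sum₁ (fun a V => φ a V + ψ a V) U = sum₁ φ U + sum₁ ψ U := by
  simp [sum₁, Multiset.sum_map_add]

theorem sum₁_neg (φ : ι → Multiset ι → W) (U : Multiset ι) :
    sum₁ (fun a V => -φ a V) U = -sum₁ φ U := by
  simp [sum₁]

theorem sum₁_sub (φ ψ : ι → Multiset ι → W) (U : Multiset ι) :
    sum₁ (fun a V => φ a V - ψ a V) U = sum₁ φ U - sum₁ ψ U := by
  simp_rw [sub_eq_add_neg]
  rw [sum₁_add, sum₁_neg]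

theorem map_sum₁ {W' : Type*} [AddCommGroup W'] (f : W →+ W') (φ : ι → Multiset ι → W)
    (U : Multiset ι) : f (sum₁ φ U) = sum₁ (fun a V => f (φ a V)) U := by
  simp [sum₁, map_multiset_sum]

theorem sum₁_smul (r : ℝ) (φ : ι → Multiset ι → W) (U : Multiset ι) :
    sum₁ (fun a V => r • φ a V) U = r • sum₁ φ U :=
  (map_sum₁ (DistribSMul.toAddMonoidHom W r) φ U).symm

theorem sum₂_add (φ ψ : ι → ι → Multiset ι → W) (U : Multiset ι) :
    sum₂ (fun a b V => φ a b V + ψ a b V) U = sum₂ φ U + sum₂ ψ U := by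
  rw [sum₂, sum₂, sum₂, ← sum₁_add]
  exact sum₁_congr fun a V _ => sum₁_add _ _ _

theorem sum₂_sub (φ ψ : ι → ι → Multiset ι → W) (U : Multiset ι) :
    sum₂ (fun a b V => φ a b V - ψ a b V) U = sum₂ φ U - sum₂ ψ U := by
  rw [sum₂, sum₂, sum₂, ← sum₁_sub]
  exact sum₁_congr fun a V _ => sum₁_sub _ _ _

theorem sum₂_smul (r : ℝ) (φ : ι → ι → Multiset ι → W) (U : Multiset ι) :
    sum₂ (fun a b V => r • φ a b V) U = r • sum₂ φ U := by
  rw [sum₂, sum₂, ← sum₁_smul]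
  exact sum₁_congr fun a V _ => sum₁_smul _ _ _

theorem sum₁_const (w : W) (U : Multiset ι) :
    sum₁ (fun _ _ => w) U = (Multiset.card U : ℝ) • w := by
  simp [sum₁, Nat.cast_smul_eq_nsmul]

theorem sum₁_eq_zero {φ : ι → Multiset ι → W} {U : Multiset ι}
    (h : ∀ a V, a ::ₘ V = U → φ a V = 0) : sum₁ φ U = 0 := by
  rw [sum₁_congr h, sum₁_const, smul_zero]

theorem sum₂_cons (φ : ι → ι → Multiset ι → W) (x : ι) (U : Multiset ι) :
    sum₂ φ (x ::ₘ U) = sum₁ (φ x) U + sum₁ (fun a V => φ a x V) U +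
      sum₂ (fun a b V => φ a b (x ::ₘ V)) U := by
  have h : sum₂ φ (x ::ₘ U) = sum₁ (φ x) U +
      sum₁ (fun a V => φ a x V + sum₁ (fun b V' => φ a b (x ::ₘ V')) V) U := by
    rw [sum₂, sum₁_cons]
    exact congrArg _ (sum₁_congr fun a V _ => sum₁_cons _ _ _)
  rw [h, sum₁_add, add_assoc, sum₂]

theorem sum₂_comm (φ : ι → ι → Multiset ι → W) (U : Multiset ι) :
    sum₂ φ U = sum₂ (fun a b => φ b a) U := by
  induction U using Multiset.induction generalizing φ with
  | empty => simp [sum₂]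
  | cons x U ih =>
    rw [sum₂_cons, sum₂_cons, ih]
    abel

/-- The element `b` is put back, so the summand does not depend on it; once `a` is removed there are
`card U - 1` choices of `b`. -/
theorem sum₂_left (φ : ι → Multiset ι → W) (U : Multiset ι) :
    sum₂ (fun a b V => φ a (b ::ₘ V)) U = ((Multiset.card U : ℝ) - 1) • sum₁ φ U := by
  rw [sum₂, ← sum₁_smul]
  refine sum₁_congr fun a V hV => ?_
  rw [sum₁_congr (ψ := fun _ _ => φ a V) fun b V' h => by rw [h], sum₁_const, ← hV]
  simp

theorem sum₂_right (φ : ι → Multiset ι → W) (U : Multiset ι) :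
    sum₂ (fun a b V => φ b (a ::ₘ V)) U = ((Multiset.card U : ℝ) - 1) • sum₁ φ U := by
  rw [sum₂_comm, sum₂_left]

theorem sum₁_const_cons (φ : Multiset ι → W) (U : Multiset ι) :
    sum₁ (fun a V => φ (a ::ₘ V)) U = (Multiset.card U : ℝ) • φ U := by
  rw [← sum₁_const]
  exact sum₁_congr fun a V h => by rw [h]

/-- Inversion of the linearized curvature in geodesic normal coordinates. -/
theorem sum₂_linearized_curvature {d : ι → ι → Multiset ι → W} (hd : ∀ i j U, d i j U = d j i U)
    (h : ∀ i U, 2 ≤ Multiset.card U → sum₁ (d i) U = 0) (i j : ι) {U : Multiset ι}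
    (hU : 2 ≤ Multiset.card U) :
    sum₂ (fun a b V => (1 / 2 : ℝ) • (d j i (a ::ₘ b ::ₘ V) - d j a (i ::ₘ b ::ₘ V)
      - d b i (a ::ₘ j ::ₘ V) + d b a (i ::ₘ j ::ₘ V))) U =
      ((1 / 2 : ℝ) * Multiset.card U * (Multiset.card U + 1)) • d i j U := by
  -- The Gauss relation for `j ::ₘ U`, with the term that removes `j` moved to the other side.
  have s (i j) : sum₁ (fun a V => d i a (j ::ₘ V)) U = -d i j U := by
    have := h i (j ::ₘ U) (by simp; omega)
    rw [sum₁_cons] at this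
    exact eq_neg_of_add_eq_zero_right this
  have t1 : sum₂ (fun a b V => d j i (a ::ₘ b ::ₘ V)) U =
      ((Multiset.card U : ℝ) - 1) • (Multiset.card U : ℝ) • d i j U := by
    rw [← hd j i, ← sum₁_const_cons, ← sum₂_left]
  have t2 : sum₂ (fun a b V => d j a (i ::ₘ b ::ₘ V)) U =
      ((Multiset.card U : ℝ) - 1) • -d i j U := by
    rw [← hd j i, ← s, ← sum₂_left]
  have t3 : sum₂ (fun a b V => d b i (a ::ₘ j ::ₘ V)) U =
      ((Multiset.card U : ℝ) - 1) • -d i j U := by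
    rw [← s, ← sum₂_right]
    exact sum₂_congr fun a b V _ => by rw [hd, Multiset.cons_swap]
  have t4 : sum₂ (fun a b V => d b a (i ::ₘ j ::ₘ V)) U = (2 : ℝ) • d i j U := by
    have : sum₂ (fun a b V => d b a (i ::ₘ j ::ₘ V)) U =
        -sum₁ (fun a V => d i a (j ::ₘ V)) U - sum₁ (fun a V => d j a (i ::ₘ V)) U := by
      rw [← sum₁_neg, ← sum₁_sub, sum₂]
      refine sum₁_congr fun a V hV => ?_
      -- The Gauss relation with both `i` and `j` split off turns the inner sum over `b` into two
      -- single terms, to which `s` then applies.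
      have := h a (i ::ₘ j ::ₘ V) (by simp)
      rw [sum₁_cons, sum₁_cons] at this
      rw [sum₁_congr (ψ := fun b V => d a b (i ::ₘ j ::ₘ V)) fun b V _ => hd _ _ _, hd i a, hd j a]
      rw [← sub_eq_zero, ← this]
      abel
    rw [this, s, s, hd j i]
    module
  -- With `n = card U` the four contributions add up to `n(n-1) + 2(n-1) + 2 = n(n+1)`.
  rw [sum₂_smul, sum₂_add, sum₂_sub, sum₂_sub, t1, t2, t3, t4]
  module

end MultisetSums

/-! ### Sums over permutations -/

section PermSums

set_option linter.unusedSectionVars false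

variable {ι : Type*} {W : Type*} [AddCommGroup W]

theorem mset_cons {m : ℕ} (c : Fin (m + 1) → ι) :
    mset c = c 0 ::ₘ mset (fun s => c s.succ) := by
  simp [mset, List.ofFn_succ]

theorem mset_comp_perm {m : ℕ} (c : Fin m → ι) (σ : Equiv.Perm (Fin m)) :
    mset (c ∘ σ) = mset c := Multiset.coe_eq_coe.2 (σ.ofFn_comp_perm c)

theorem card_mset {m : ℕ} (c : Fin m → ι) : Multiset.card (mset c) = m := by simp [mset]

theorem mset_append {m n : ℕ} (c : Fin m → ι) (d : Fin n → ι) :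
    mset (Fin.append c d) = mset c + mset d := by
  simp [mset, List.ofFn_fin_append]

theorem mset_comp {ι' : Type*} {m : ℕ} (c : Fin m → ι) (f : ι → ι') :
    mset (f ∘ c) = (mset c).map f := by
  simp [mset, ← List.map_ofFn]

/-- A permutation is determined by the image `p` of `0` and a permutation of the remaining indices,
which `swap 0 p` relabels. -/
theorem sum_perm_succ {m : ℕ} (Ψ : ι → (Fin m → ι) → W) (c : Fin (m + 1) → ι) :
    ∑ σ : Equiv.Perm (Fin (m + 1)), Ψ (c (σ 0)) (fun s => c (σ s.succ)) =
      ∑ p, ∑ e : Equiv.Perm (Fin m),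
        Ψ (c p) ((fun s : Fin m => c (Equiv.swap 0 p s.succ)) ∘ e) := by
  rw [← Equiv.Perm.decomposeFin.symm.sum_comp, Fintype.sum_prod_type]
  refine Finset.sum_congr rfl fun p _ => Finset.sum_congr rfl fun e _ => ?_
  simp [Function.comp_def]

variable [DecidableEq ι]

theorem mset_swap {m : ℕ} (c : Fin (m + 1) → ι) (p : Fin (m + 1)) :
    mset (fun s : Fin m => c (Equiv.swap 0 p s.succ)) = (mset c).erase (c p) := by
  rw [← mset_comp_perm c (Equiv.swap 0 p), mset_cons (c ∘ Equiv.swap 0 p)]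
  simp

theorem sum_univ_mset {m : ℕ} (c : Fin m → ι) (f : ι → W) :
    ∑ p, f (c p) = ((mset c).map f).sum := by
  simp [mset, List.sum_ofFn, Function.comp_def]

/-- Once the first entry is chosen, the `m!` orderings of the rest give the same multiset. -/
theorem sum_perm_eq_sum₁ {m : ℕ} (φ : ι → Multiset ι → W) (c : Fin (m + 1) → ι) :
    ∑ σ : Equiv.Perm (Fin (m + 1)), φ (c (σ 0)) (mset fun s => c (σ s.succ)) =
      m.factorial • sum₁ φ (mset c) := by
  rw [sum_perm_succ (fun a f => φ a (mset f)), sum₁, ← sum_univ_mset c, Finset.smul_sum]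
  refine Finset.sum_congr rfl fun p _ => ?_
  simp only [mset_comp_perm, mset_swap]
  simp [Fintype.card_perm]

theorem sum_perm_eq_sum₂ {m : ℕ} (φ : ι → ι → Multiset ι → W) (c : Fin (m + 2) → ι) :
    ∑ σ : Equiv.Perm (Fin (m + 2)), φ (c (σ 0)) (c (σ 1)) (mset fun s => c (σ s.succ.succ)) =
      m.factorial • sum₂ φ (mset c) := by
  have := sum_perm_succ (fun a f => φ a (f 0) (mset fun s => f s.succ)) c
  simp only [Fin.succ_zero_eq_one] at this
  rw [this, sum₂, sum₁, ← sum_univ_mset c, Finset.smul_sum]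
  refine Finset.sum_congr rfl fun p _ => ?_
  rw [← mset_swap, ← sum_perm_eq_sum₁]
  simp

end PermSums

/-! ### Functions given by polynomials without terms of low degree -/

section PolyOrder

variable {Ω V : Type*} (val : Ω → V → ℝ)

/-- The functions on `Ω` given by polynomials in `val` all of whose terms have degree at
least `d`. -/
def polyOrder (d : ℕ) : Submodule ℝ (Ω → ℝ) where
  carrier := {v | ∃ q : MvPolynomial V ℝ, (∀ s ∈ q.support, d ≤ s.degree) ∧
    ∀ A, v A = MvPolynomial.eval (val A) q}
  add_mem' := by
    classical
    rintro v w ⟨p, hp, hv⟩ ⟨q, hq, hw⟩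
    refine ⟨p + q, fun s hs => ?_, fun A => by simp [hv, hw]⟩
    rcases Finset.mem_union.1 (MvPolynomial.support_add hs) with h | h
    exacts [hp s h, hq s h]
  zero_mem' := ⟨0, by simp, by simp⟩
  smul_mem' := by
    rintro r v ⟨p, hp, hv⟩
    exact ⟨r • p, fun s hs => hp s (MvPolynomial.support_smul hs),
      fun A => by simp [hv, MvPolynomial.smul_eval]⟩

variable {val}

theorem polyOrder_mono {d e : ℕ} (h : d ≤ e) : polyOrder val e ≤ polyOrder val d :=
  fun _ ⟨p, hp, hv⟩ => ⟨p, fun s hs => h.trans (hp s hs), hv⟩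

theorem mul_mem_polyOrder {d e : ℕ} {v w : Ω → ℝ} (hv : v ∈ polyOrder val d)
    (hw : w ∈ polyOrder val e) : v * w ∈ polyOrder val (d + e) := by
  classical
  obtain ⟨p, hp, hv⟩ := hv
  obtain ⟨q, hq, hw⟩ := hw
  refine ⟨p * q, fun s hs => ?_, fun A => by simp [hv, hw]⟩
  obtain ⟨a, ha, b, hb, rfl⟩ := Finset.mem_add.1 (MvPolynomial.support_mul p q hs)
  rw [map_add]
  exact add_le_add (hp a ha) (hq b hb)

theorem const_mem_polyOrder (r : ℝ) : (fun _ => r) ∈ polyOrder val 0 :=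
  ⟨MvPolynomial.C r, fun _ _ => Nat.zero_le _, fun A => by simp⟩

theorem val_mem_polyOrder (x : V) : (fun A => val A x) ∈ polyOrder val 1 := by
  refine ⟨MvPolynomial.X x, fun s hs => ?_, fun A => by simp⟩
  rw [MvPolynomial.support_X, Finset.mem_singleton] at hs
  simp [hs]

end PolyOrder

/-! ### Families of functions whose jets are given by polynomials -/

section JetOrder

open Filter

variable {Ω V : Type*} (val : Ω → V → ℝ) {κ : Type} [Fintype κ] [DecidableEq κ]

/-- Families of functions, smooth at the origin, whose partial derivatives at the origin of order
at most `r` are given by polynomials in `val` all of whose terms have degree at least `d`. -/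
def jetOrder (d r : ℕ) : Submodule ℝ (Ω → (κ → ℝ) → ℝ) where
  carrier := {F | (∀ A, SmoothAt (F A)) ∧
    ∀ c : Multiset κ, Multiset.card c ≤ r → (fun A => jet (F A) c) ∈ polyOrder val d}
  add_mem' := by
    rintro F G ⟨hF, hF'⟩ ⟨hG, hG'⟩
    refine ⟨fun A => (hF A).add (hG A), fun c hc => ?_⟩
    convert (polyOrder val d).add_mem (hF' c hc) (hG' c hc) using 1
    ext A
    exact jet_add (hF A) (hG A) c
  zero_mem' := by
    refine ⟨fun _ => SmoothAt.zero, fun c _ => ?_⟩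
    convert (polyOrder val d).zero_mem using 1
    ext A
    exact jet_fun_zero c
  smul_mem' := by
    rintro r F ⟨hF, hF'⟩
    refine ⟨fun A => SmoothAt.smul r (hF A), fun c hc => ?_⟩
    convert (polyOrder val d).smul_mem r (hF' c hc) using 1
    ext A
    exact jet_smul r (hF A) c

variable {val} {d e r s : ℕ} {F F' : Ω → (κ → ℝ) → ℝ}

theorem jet_mem (hF : F ∈ jetOrder val d r) {c : Multiset κ} (hc : Multiset.card c ≤ r) :
    (fun A => jet (F A) c) ∈ polyOrder val d := hF.2 c hc

theorem jetOrder_congr (hF : F ∈ jetOrder val d r) (h : ∀ A, F' A =ᶠ[𝓝 0] F A) :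
    F' ∈ jetOrder val d r := by
  refine ⟨fun A => (hF.1 A).congr (h A), fun c hc => ?_⟩
  convert hF.2 c hc using 2
  exact jet_congr (h _) c

theorem jetOrder_mono (hd : d ≤ e) (hr : r ≤ s) :
    jetOrder (κ := κ) val e s ≤ jetOrder val d r :=
  fun _ hF => ⟨hF.1, fun c hc => polyOrder_mono hd (hF.2 c (hc.trans hr))⟩

theorem mem_jetOrder_zero_iff :
    F ∈ jetOrder val d 0 ↔ (∀ A, SmoothAt (F A)) ∧ (fun A => F A 0) ∈ polyOrder val d := by
  refine and_congr_right fun hF => ⟨fun h => ?_, fun h c hc => ?_⟩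
  · simpa only [jet_zero] using h 0 (by simp)
  · obtain rfl : c = 0 := Multiset.card_eq_zero.1 (Nat.le_zero.1 hc)
    simpa only [jet_zero] using h

/-- The recursion in `r` through which closure under products and inverses is proved. -/
theorem mem_jetOrder_succ_iff :
    F ∈ jetOrder val d (r + 1) ↔ (∀ A, SmoothAt (F A)) ∧ (fun A => F A 0) ∈ polyOrder val d ∧
      ∀ i, (fun A => pd (F A) i) ∈ jetOrder val d r := by
  refine and_congr_right fun hF => ⟨fun h => ⟨?_, fun i => ⟨fun A => (hF A).pd i, fun c hc => ?_⟩⟩,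
    fun h c hc => ?_⟩
  · simpa only [jet_zero] using h 0 (by simp)
  · simpa only [jet_cons (hF _)] using h (i ::ₘ c) (by simpa using hc)
  · induction c using Multiset.induction with
    | empty => simpa only [jet_zero] using h.1
    | cons i c _ =>
      simp only [jet_cons (hF _)]
      exact (h.2 i).2 c (by simpa using hc)

theorem pd_mem (hF : F ∈ jetOrder val d (r + 1)) (i : κ) :
    (fun A => pd (F A) i) ∈ jetOrder val d r := (mem_jetOrder_succ_iff.1 hF).2.2 i

theorem mul_mem_jetOrder (hF : F ∈ jetOrder val d r) (hF' : F' ∈ jetOrder val e r) :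
    F * F' ∈ jetOrder val (d + e) r := by
  induction r generalizing F F' with
  | zero =>
    rw [mem_jetOrder_zero_iff] at *
    exact ⟨fun A => (hF.1 A).mul (hF'.1 A), mul_mem_polyOrder hF.2 hF'.2⟩
  | succ r ih =>
    have h₁ := mem_jetOrder_succ_iff.1 hF
    have h₂ := mem_jetOrder_succ_iff.1 hF'
    refine mem_jetOrder_succ_iff.2 ⟨fun A => (h₁.1 A).mul (h₂.1 A),
      mul_mem_polyOrder h₁.2.1 h₂.2.1, fun i => ?_⟩
    refine jetOrder_congr ((jetOrder val (d + e) r).add_mem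
      (ih (h₁.2.2 i) (jetOrder_mono le_rfl r.le_succ hF'))
      (ih (jetOrder_mono le_rfl r.le_succ hF) (h₂.2.2 i))) fun A => ?_
    exact pd_mul (h₁.1 A) (h₂.1 A) i

theorem const_mem_jetOrder (a : ℝ) : (fun _ _ => a) ∈ jetOrder (Ω := Ω) (κ := κ) val 0 r := by
  refine ⟨fun _ => SmoothAt.const a, fun c _ => ?_⟩
  induction c using Multiset.induction with
  | empty => simpa only [jet_zero] using const_mem_polyOrder a
  | cons i c _ => simpa only [jet_const] using const_mem_polyOrder 0

theorem prod_mem_jetOrder {σ : Type*} (t : Finset σ) {F : σ → Ω → (κ → ℝ) → ℝ}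
    (hF : ∀ a, F a ∈ jetOrder val 0 r) : ∏ a ∈ t, F a ∈ jetOrder val 0 r := by
  classical
  induction t using Finset.induction_on with
  | empty => exact const_mem_jetOrder 1
  | insert a t ha ih =>
    rw [Finset.prod_insert ha]
    exact mul_mem_jetOrder (hF a) ih

/-- Polynomials are not closed under inversion. The common value `a` at the origin makes `1 / F`
constant there, and `∂(1/F) = -∂F / F²` reduces higher orders to products. -/
theorem inv_mem_jetOrder (hF : F ∈ jetOrder val 0 r) {a : ℝ} (ha : a ≠ 0) (h0 : ∀ A, F A 0 = a) :
    F⁻¹ ∈ jetOrder val 0 r := by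
  have hne : ∀ A, F A 0 ≠ 0 := fun A => by rwa [h0 A]
  have hv : (fun A => F⁻¹ A 0) ∈ polyOrder val 0 := by
    simpa [h0] using const_mem_polyOrder a⁻¹
  induction r with
  | zero => exact mem_jetOrder_zero_iff.2 ⟨fun A => (hF.1 A).inv (hne A), hv⟩
  | succ r ih =>
    have h := ih (jetOrder_mono le_rfl r.le_succ hF)
    refine mem_jetOrder_succ_iff.2 ⟨fun A => (hF.1 A).inv (hne A), hv, fun i => ?_⟩
    exact jetOrder_congr ((jetOrder val 0 r).smul_mem (-1 : ℝ)
      (mul_mem_jetOrder (pd_mem hF i) (mul_mem_jetOrder h h))) fun A => pd_inv (hF.1 A) (hne A) i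

theorem comp_mem_jetOrder {κ' : Type} [Fintype κ'] [DecidableEq κ'] (L : (κ' → ℝ) →L[ℝ] (κ → ℝ))
    (e : κ' → κ) (hL : ∀ i, L (Pi.single i 1) = Pi.single (e i) 1) (hF : F ∈ jetOrder val d r) :
    (fun A => F A ∘ L) ∈ jetOrder val d r := by
  refine ⟨fun A => (hF.1 A).comp_clm L, fun c hc => ?_⟩
  simp only [jet_comp L e hL (hF.1 _)]
  exact hF.2 _ (by simpa using hc)

theorem det_mem_jetOrder {M : Ω → (κ → ℝ) → Matrix κ κ ℝ}
    (hM : ∀ i j, (fun A y => M A y i j) ∈ jetOrder val 0 r) :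
    (fun A y => (M A y).det) ∈ jetOrder val 0 r := by
  have : (fun A y => (M A y).det) = ∑ σ : Equiv.Perm κ, ((Equiv.Perm.sign σ : ℤ) : ℝ) •
      ∏ i, fun A y => M A y (σ i) i := by
    ext A y
    simp [Matrix.det_apply, Finset.sum_apply, Finset.prod_apply, Units.smul_def]
  rw [this]
  exact Submodule.sum_mem _ fun σ _ => Submodule.smul_mem _ _ (prod_mem_jetOrder _ fun i => hM _ _)

/-- Cramer's rule: an entry of the inverse is a quotient of determinants whose denominator takes the
fixed value `h.det` at the origin. -/
theorem matrix_inv_mem_jetOrder {M : Ω → (κ → ℝ) → Matrix κ κ ℝ}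
    (hM : ∀ i j, (fun A y => M A y i j) ∈ jetOrder val 0 r) {h : Matrix κ κ ℝ} (hdet : h.det ≠ 0)
    (h0 : ∀ A, M A 0 = h) (i j : κ) : (fun A y => (M A y)⁻¹ i j) ∈ jetOrder val 0 r := by
  have : (fun A y => (M A y)⁻¹ i j) = (fun A y => (M A y).det)⁻¹ *
      fun A y => ((M A y).updateRow j (Pi.single i 1)).det := by
    ext A y
    simp [Matrix.inv_def, Matrix.adjugate_apply]
  rw [this]
  refine mul_mem_jetOrder (inv_mem_jetOrder (det_mem_jetOrder hM) hdet fun A => by rw [h0 A])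
    (det_mem_jetOrder fun a b => ?_)
  by_cases ha : a = j
  · subst ha
    simpa using const_mem_jetOrder ((Pi.single i 1 : κ → ℝ) b)
  · simpa [Matrix.updateRow_ne ha] using hM a b

end JetOrder

/-! ### Covariant and partial derivatives -/

section Covariant

open Filter

variable {Ω V : Type*} {val : Ω → V → ℝ} {κ : Type} [Fintype κ] [DecidableEq κ] {I : Type*} {s : ℕ}
  {F : (m : ℕ) → I → (Fin m → κ) → Ω → (κ → ℝ) → ℝ}

/-- `F m` models an `m`-th covariant derivative. If partial and covariant derivatives differ by
terms of degree two, then control of all values at the origin gives control of partial derivatives,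
one order per induction step. One order beyond `s` is gained, because order `t + 1` needs the
comparison only at order `t`. -/
theorem covariant_mem_jetOrder (hF : ∀ m a c A, SmoothAt (F m a c A))
    (hval : ∀ m a c, (fun A => F m a c A 0) ∈ polyOrder val 1)
    (hE : ∀ t ≤ s, (∀ m a c, F m a c ∈ jetOrder val 1 t) → ∀ m a (c : Fin (m + 1) → κ),
      (fun A => pd (F m a (fun i => c i.castSucc) A) (c (Fin.last m)) - F (m + 1) a c A) ∈
        jetOrder val 2 t) {t : ℕ} (ht : t ≤ s + 1) (m : ℕ) (a : I) (c : Fin m → κ) :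
    F m a c ∈ jetOrder val 1 t := by
  induction t generalizing m a c with
  | zero => exact mem_jetOrder_zero_iff.2 ⟨hF m a c, hval m a c⟩
  | succ t ih =>
    have ih := ih (by omega)
    refine mem_jetOrder_succ_iff.2 ⟨hF m a c, hval m a c, fun i => ?_⟩
    -- The partial derivative along `i` is compared with the covariant derivative whose last index
    -- is `i`, hence `Fin.snoc c i`.
    have h := (jetOrder val 1 t).add_mem (jetOrder_mono one_le_two le_rfl
      (hE t (by omega) ih m a (Fin.snoc c i))) (ih (m + 1) a (Fin.snoc c i))
    refine jetOrder_congr h fun A => ?_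
    simp only [Fin.snoc_castSucc, Fin.snoc_last]
    exact Eventually.of_forall fun y => by simp

/-- Covariant derivatives are replaced by partial ones one at a time, starting with the last; each
replacement costs a term of degree two. -/
theorem covariant_jet_sub_mem (hF : ∀ m a c A, SmoothAt (F m a c A))
    (hval : ∀ m a c, (fun A => F m a c A 0) ∈ polyOrder val 1)
    (hE : ∀ t ≤ s, (∀ m a c, F m a c ∈ jetOrder val 1 t) → ∀ m a (c : Fin (m + 1) → κ),
      (fun A => pd (F m a (fun i => c i.castSucc) A) (c (Fin.last m)) - F (m + 1) a c A) ∈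
        jetOrder val 2 t) (m : ℕ) (a : I) (c : Fin m → κ) (e : Multiset κ)
    (hm : m + Multiset.card e ≤ s + 1) :
    (fun A => jet (F m a c A) e - jet (F 0 a Fin.elim0 A) (mset c + e)) ∈ polyOrder val 2 := by
  induction m generalizing e with
  | zero =>
    have : c = Fin.elim0 := Subsingleton.elim _ _
    subst this
    simp only [mset, List.ofFn_zero, Multiset.coe_nil, zero_add, sub_self]
    exact (polyOrder val 2).zero_mem
  | succ m ih =>
    have h1 := ih (fun i => c i.castSucc) (c (Fin.last m) ::ₘ e) (by simp; omega)
    -- Only jets of order `card e ≤ s - m` of the comparison error are needed.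
    have h2 := jet_mem (c := e) (hE (s - m) (by omega) (covariant_mem_jetOrder hF hval hE (by omega))
      m a c) (by omega)
    convert (polyOrder val 2).sub_mem h1 h2 using 1
    ext A
    simp only [Pi.sub_apply]
    rw [jet_sub ((hF _ _ _ _).pd _) (hF _ _ _ _), jet_cons (hF _ _ _ _), mset_snoc c,
      Multiset.cons_add, Multiset.add_cons]
    ring

end Covariant

/-! ### Christoffel symbols and curvature -/

section Curvature

open Filter

variable {κ : Type} [Fintype κ] [DecidableEq κ]

/-- The Christoffel symbols of the first kind `Γ_{p,jm}`. -/
noncomputable def christoffelLow (G : (κ → ℝ) → Matrix κ κ ℝ) (p j m : κ) : (κ → ℝ) → ℝ :=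
  (1 / 2 : ℝ) • (pd (fun w => G w m p) j + pd (fun w => G w j p) m - pd (fun w => G w j m) p)

/-- The part of the curvature `R_{ijab}` that is linear in the second derivatives. -/
noncomputable def linCurvature (G : (κ → ℝ) → Matrix κ κ ℝ) (a : Fin 4 → κ) : (κ → ℝ) → ℝ :=
  pd (christoffelLow G (a 0) (a 3) (a 1)) (a 2) - pd (christoffelLow G (a 0) (a 2) (a 1)) (a 3)

theorem sum_mul_christoffel {G : (κ → ℝ) → Matrix κ κ ℝ} {y : κ → ℝ} (h : (G y).det ≠ 0)
    (p j m : κ) : ∑ s, G y p s * christoffel G s j m y = christoffelLow G p j m y := by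
  have h1 : G y * (G y)⁻¹ = 1 := Matrix.mul_nonsing_inv _ (isUnit_iff_ne_zero.2 h)
  simp only [christoffel, Finset.mul_sum]
  rw [Finset.sum_comm]
  have h2 : ∀ t, ∑ s, G y p s * (1 / 2 * ((G y)⁻¹ s t * (pd (fun w => G w m t) j y +
      pd (fun w => G w j t) m y - pd (fun w => G w j m) t y))) =
      if p = t then christoffelLow G p j m y else 0 := fun t => by
    have h3 := congrFun (congrFun h1 p) t
    rw [Matrix.mul_apply, Matrix.one_apply] at h3
    have h4 : ∀ x : ℝ, ∑ s, G y p s * (1 / 2 * ((G y)⁻¹ s t * x)) =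
        (∑ s, G y p s * (G y)⁻¹ s t) * (1 / 2 * x) := fun x => by
      rw [Finset.sum_mul]
      exact Finset.sum_congr rfl fun s _ => by ring
    rw [h4, h3]
    split_ifs with hpt
    · subst hpt
      simp [christoffelLow]
    · simp
  rw [Finset.sum_congr rfl fun t _ => h2 t]
  simp

theorem SmoothAt.det {G : (κ → ℝ) → Matrix κ κ ℝ} (hG : ∀ i j, SmoothAt fun y => G y i j) :
    SmoothAt fun y => (G y).det := by
  simp only [Matrix.det_apply, Units.smul_def]
  exact ContDiffAt.sum fun σ _ => ContDiffAt.const_smul _ (contDiffAt_prod fun i _ => hG _ _)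

theorem SmoothAt.eventually_det_ne_zero {G : (κ → ℝ) → Matrix κ κ ℝ}
    (hG : ∀ i j, SmoothAt fun y => G y i j) (h0 : (G 0).det ≠ 0) :
    ∀ᶠ y in 𝓝 0, (G y).det ≠ 0 :=
  (SmoothAt.det hG).continuousAt.eventually_ne h0

variable {G : (κ → ℝ) → Matrix κ κ ℝ} (hG : ∀ i j, SmoothAt fun y => G y i j)
include hG

theorem smoothAt_christoffelLow (p j m : κ) : SmoothAt (christoffelLow G p j m) :=
  SmoothAt.smul _ ((((hG _ _).pd _).add ((hG _ _).pd _)).sub ((hG _ _).pd _))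

theorem smoothAt_linCurvature (a : Fin 4 → κ) : SmoothAt (linCurvature G a) :=
  ((smoothAt_christoffelLow hG _ _ _).pd _).sub ((smoothAt_christoffelLow hG _ _ _).pd _)

theorem jet_christoffelLow (p j m : κ) (c : Multiset κ) :
    jet (christoffelLow G p j m) c = 1 / 2 * (jet (fun y => G y m p) (j ::ₘ c) +
      jet (fun y => G y j p) (m ::ₘ c) - jet (fun y => G y j m) (p ::ₘ c)) := by
  rw [christoffelLow, jet_smul _ ((((hG _ _).pd _).add ((hG _ _).pd _)).sub ((hG _ _).pd _)),
    jet_sub (((hG _ _).pd _).add ((hG _ _).pd _)) ((hG _ _).pd _),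
    jet_add ((hG _ _).pd _) ((hG _ _).pd _), jet_cons (hG _ _), jet_cons (hG _ _),
    jet_cons (hG _ _)]

theorem jet_linCurvature (i j a b : κ) (c : Multiset κ) :
    jet (linCurvature G ![i, j, a, b]) c = 1 / 2 * (jet (fun y => G y b i) (j ::ₘ a ::ₘ c) -
      jet (fun y => G y b j) (i ::ₘ a ::ₘ c) - jet (fun y => G y a i) (j ::ₘ b ::ₘ c) +
      jet (fun y => G y a j) (i ::ₘ b ::ₘ c)) := by
  rw [linCurvature, jet_sub ((smoothAt_christoffelLow hG _ _ _).pd _)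
    ((smoothAt_christoffelLow hG _ _ _).pd _), ← jet_cons (smoothAt_christoffelLow hG _ _ _),
    ← jet_cons (smoothAt_christoffelLow hG _ _ _), jet_christoffelLow hG, jet_christoffelLow hG]
  simp
  rw [Multiset.cons_swap b a]
  ring

/-- The curvature is its linear part plus terms quadratic in first derivatives. -/
theorem curvature_eventuallyEq (h0 : (G 0).det ≠ 0)
    (hΓ : ∀ i j m, SmoothAt (christoffel G i j m)) (a : Fin 4 → κ) :
    curvature G a =ᶠ[𝓝 0] linCurvature G a
      - (∑ t, pd (fun y => G y (a 0) t) (a 2) * christoffel G t (a 3) (a 1))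
      + (∑ t, pd (fun y => G y (a 0) t) (a 3) * christoffel G t (a 2) (a 1))
      + ∑ t, (fun y => G y (a 0) t) * ∑ u, (christoffel G t (a 2) u * christoffel G u (a 3) (a 1) -
          christoffel G t (a 3) u * christoffel G u (a 2) (a 1)) := by
  -- Differentiating `Γ_{p,jm} = G_{pt} Γᵗ_{jm}`: the derivative of the raised symbol, lowered
  -- again, is the derivative of the lowered symbol up to a product of first-order terms.
  have key : ∀ j m i : κ, pd (christoffelLow G (a 0) j m) i =ᶠ[𝓝 0]
      (∑ t, pd (fun y => G y (a 0) t) i * christoffel G t j m) +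
        ∑ t, (fun y => G y (a 0) t) * pd (christoffel G t j m) i := fun j m i => by
    have h1 : christoffelLow G (a 0) j m =ᶠ[𝓝 0]
        ∑ t, (fun y => G y (a 0) t) * christoffel G t j m := by
      filter_upwards [SmoothAt.eventually_det_ne_zero hG h0] with y hy
      rw [← sum_mul_christoffel hy]
      simp
    refine (pd_congr h1 i).trans ?_
    rw [← Finset.sum_add_distrib]
    have h2 : ∀ᶠ y in 𝓝 0, ∀ t, pd ((fun y => G y (a 0) t) * christoffel G t j m) i y =
        (pd (fun y => G y (a 0) t) i * christoffel G t j m +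
          (fun y => G y (a 0) t) * pd (christoffel G t j m) i) y :=
      eventually_all.2 fun t => pd_mul (hG _ _) (hΓ _ _ _) i
    have h3 : ∀ᶠ y in 𝓝 0, ∀ t, DifferentiableAt ℝ ((fun y => G y (a 0) t) * christoffel G t j m) y :=
      eventually_all.2 fun t => ((hG _ _).mul (hΓ _ _ _)).eventually_differentiableAt
    filter_upwards [h2, h3] with y h2 h3
    rw [Finset.sum_apply, ← Finset.sum_congr rfl fun t _ => h2 t]
    simp only [pd]
    rw [fderiv_sum fun t _ => h3 t]
    simp
  filter_upwards [key (a 3) (a 1) (a 2), key (a 2) (a 1) (a 3)] with y h1 h2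
  simp only [Pi.add_apply, Pi.sub_apply, linCurvature, h1, h2, curvature, curvatureUp,
    Finset.sum_apply, Pi.mul_apply, mul_add, mul_sub, Finset.sum_add_distrib,
    Finset.sum_sub_distrib]
  ring

end Curvature

/-! ### Curvature of a family of metrics, modulo terms of degree two -/

section CurvatureFamily

open Filter

variable {Ω V : Type*} {val : Ω → V → ℝ} {κ : Type} [Fintype κ] [DecidableEq κ] {s : ℕ}
  {G : Ω → (κ → ℝ) → Matrix κ κ ℝ} {h : Matrix κ κ ℝ}

variable (hG : ∀ A i j, SmoothAt fun y => G A y i j) (h0 : ∀ A, G A 0 = h)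
  (hs : ∀ i j m, (fun A => pd (fun y => G A y i j) m) ∈ jetOrder val 1 s)
include hG h0 hs

theorem metric_mem_jetOrder (i j : κ) : (fun A y => G A y i j) ∈ jetOrder val 0 (s + 1) := by
  refine mem_jetOrder_succ_iff.2 ⟨fun A => hG A i j, ?_, fun m => jetOrder_mono zero_le_one le_rfl
    (hs i j m)⟩
  simpa only [h0] using const_mem_polyOrder (h i j)

variable (hdet : h.det ≠ 0)
include hdet

theorem christoffel_mem_jetOrder (i j m : κ) :
    (fun A => christoffel (G A) i j m) ∈ jetOrder val 1 s := by
  have : (fun A => christoffel (G A) i j m) = (1 / 2 : ℝ) • ∑ t, (fun A y => (G A y)⁻¹ i t) *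
      ((fun A => pd (fun y => G A y m t) j) + (fun A => pd (fun y => G A y j t) m) -
        fun A => pd (fun y => G A y j m) t) := by
    ext A y
    simp [christoffel, Finset.sum_apply]
  rw [this]
  refine Submodule.smul_mem _ _ (Submodule.sum_mem _ fun t _ => ?_)
  rw [← zero_add 1]
  refine mul_mem_jetOrder (jetOrder_mono le_rfl s.le_succ
    (matrix_inv_mem_jetOrder (metric_mem_jetOrder hG h0 hs) hdet h0 i t)) ?_
  exact Submodule.sub_mem _ (Submodule.add_mem _ (hs _ _ _) (hs _ _ _)) (hs _ _ _)

/-- Every correction term contains two factors among first derivatives of the metric and Christoffel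
symbols, each of degree at least one. -/
theorem curvature_sub_linCurvature_mem (a : Fin 4 → κ) :
    (fun A => curvature (G A) a - linCurvature (G A) a) ∈ jetOrder val 2 s := by
  have hΓ := christoffel_mem_jetOrder hG h0 hs hdet
  have hm := fun i j => jetOrder_mono le_rfl s.le_succ (metric_mem_jetOrder hG h0 hs i j)
  have hmem : - (∑ t, (fun A => pd (fun y => G A y (a 0) t) (a 2)) *
        fun A => christoffel (G A) t (a 3) (a 1))
      + (∑ t, (fun A => pd (fun y => G A y (a 0) t) (a 3)) *
        fun A => christoffel (G A) t (a 2) (a 1))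
      + ∑ t, (fun A y => G A y (a 0) t) * ∑ u, ((fun A => christoffel (G A) t (a 2) u) *
          (fun A => christoffel (G A) u (a 3) (a 1)) -
        (fun A => christoffel (G A) t (a 3) u) * fun A => christoffel (G A) u (a 2) (a 1)) ∈
      jetOrder val 2 s := by
    refine Submodule.add_mem _ (Submodule.add_mem _ (Submodule.neg_mem _ (Submodule.sum_mem _
      fun t _ => mul_mem_jetOrder (hs _ _ _) (hΓ _ _ _))) (Submodule.sum_mem _
      fun t _ => mul_mem_jetOrder (hs _ _ _) (hΓ _ _ _))) (Submodule.sum_mem _ fun t _ => ?_)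
    rw [← zero_add 2]
    exact mul_mem_jetOrder (hm _ _) (Submodule.sum_mem _ fun u _ => Submodule.sub_mem _
      (mul_mem_jetOrder (hΓ _ _ _) (hΓ _ _ _)) (mul_mem_jetOrder (hΓ _ _ _) (hΓ _ _ _)))
  refine jetOrder_congr hmem fun A => ?_
  filter_upwards [curvature_eventuallyEq (hG A) (by rwa [h0]) (fun i j m => (hΓ i j m).1 A) a]
    with y hy
  rw [Pi.sub_apply, hy]
  simp only [Pi.add_apply, Pi.sub_apply, Pi.neg_apply, Pi.mul_apply, Finset.sum_apply]
  ring

theorem smoothAt_nablaCurvature (m : ℕ) (a : Fin 4 → κ) (c : Fin m → κ) (A : Ω) :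
    SmoothAt (nablaCurvature (G A) m a c) := by
  have hΓ := fun i j m => (christoffel_mem_jetOrder hG h0 hs hdet i j m).1 A
  induction m generalizing a with
  | zero =>
    refine ((smoothAt_linCurvature (hG A) a).add
      ((curvature_sub_linCurvature_mem hG h0 hs hdet a).1 A)).congr (Eventually.of_forall fun y => ?_)
    simp [nablaCurvature]
  | succ m ih =>
    exact (((ih _ _).pd _).sub (ContDiffAt.sum fun i _ => ContDiffAt.sum fun p _ =>
      (hΓ _ _ _).mul (ih _ _))).sub (ContDiffAt.sum fun i _ => ContDiffAt.sum fun p _ =>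
      (hΓ _ _ _).mul (ih _ _))

/-- The difference is a sum of products of a Christoffel symbol and a covariant derivative of the
curvature, both of degree at least one. -/
theorem pd_sub_nablaCurvature_mem (t : ℕ) (ht : t ≤ s)
    (H : ∀ m a c, (fun A => nablaCurvature (G A) m a c) ∈ jetOrder val 1 t) (m : ℕ)
    (a : Fin 4 → κ) (c : Fin (m + 1) → κ) :
    (fun A => pd (nablaCurvature (G A) m a fun i => c i.castSucc) (c (Fin.last m)) -
      nablaCurvature (G A) (m + 1) a c) ∈ jetOrder val 2 t := by
  have hΓ := fun i j m => jetOrder_mono le_rfl ht (christoffel_mem_jetOrder hG h0 hs hdet i j m)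
  have : (fun A => pd (nablaCurvature (G A) m a fun i => c i.castSucc) (c (Fin.last m)) -
      nablaCurvature (G A) (m + 1) a c) =
      (∑ i : Fin 4, ∑ p, (fun A => christoffel (G A) p (c (Fin.last m)) (a i)) *
        fun A => nablaCurvature (G A) m (Function.update a i p) (fun t => c t.castSucc)) +
      ∑ i : Fin m, ∑ p, (fun A => christoffel (G A) p (c (Fin.last m)) (c i.castSucc)) *
        fun A => nablaCurvature (G A) m a (Function.update (fun t => c t.castSucc) i p) := by
    ext A y
    simp only [nablaCurvature, Pi.add_apply, Pi.sub_apply, Pi.mul_apply, Finset.sum_apply]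
    ring
  rw [this]
  exact Submodule.add_mem _
    (Submodule.sum_mem _ fun i _ => Submodule.sum_mem _ fun p _ =>
      mul_mem_jetOrder (hΓ _ _ _) (H _ _ _))
    (Submodule.sum_mem _ fun i _ => Submodule.sum_mem _ fun p _ =>
      mul_mem_jetOrder (hΓ _ _ _) (H _ _ _))

variable (hval : ∀ m a c, (fun A => nablaCurvature (G A) m a c 0) ∈ polyOrder val 1)
include hval

/-- The order rises from `s` to `s + 1`, which drives the induction on the order of the metric jets.
-/
theorem curvature_mem_jetOrder (a : Fin 4 → κ) :
    (fun A => curvature (G A) a) ∈ jetOrder val 1 (s + 1) :=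
  covariant_mem_jetOrder (F := fun m a c A => nablaCurvature (G A) m a c)
    (smoothAt_nablaCurvature hG h0 hs hdet) hval (pd_sub_nablaCurvature_mem hG h0 hs hdet) le_rfl
    0 a Fin.elim0

theorem nablaCurvature_sub_jet_mem (m : ℕ) (hm : m ≤ s + 1) (a : Fin 4 → κ) (c : Fin m → κ) :
    (fun A => nablaCurvature (G A) m a c 0 - jet (curvature (G A) a) (mset c)) ∈
      polyOrder val 2 := by
  have := covariant_jet_sub_mem (F := fun m a c A => nablaCurvature (G A) m a c)
    (smoothAt_nablaCurvature hG h0 hs hdet) hval (pd_sub_nablaCurvature_mem hG h0 hs hdet) m a c 0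
    (by simpa using hm)
  simp only [jet_zero, add_zero] at this
  exact this

end CurvatureFamily

/-! ### Gauss lemma -/

section GaussLemma

variable {ι : Type*} [DecidableEq ι] {W : Type*} [AddCommGroup W] [Module ℝ W]
  {d : ι → ι → Multiset ι → W} (hd : ∀ i j U, d i j U = d j i U)
  (h : ∀ p U, sum₂ (fun a b V => d b p (a ::ₘ V) + d a p (b ::ₘ V) - d a b (p ::ₘ V)) U = 0)
include hd h

/-- The Taylor coefficients of `x^a x^b Γ_{p,ab} = 0` equate the sum of `∂_p g_{ab}` with twice that
of `∂_a g_{bp}`. Splitting `p` off the left side adds two more copies of `sum₁ (d p) U`. -/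
theorem sum₂_cons_eq (p : ι) (U : Multiset ι) :
    sum₂ d (p ::ₘ U) = (2 * Multiset.card U : ℝ) • sum₁ (d p) U := by
  have h1 := h p U
  have h2 : sum₁ (fun a V => d a p V) U = sum₁ (d p) U := sum₁_congr fun a V _ => hd a p V
  rw [sum₂_sub, sum₂_add, sum₂_left (fun a V => d a p V), sum₂_right (fun a V => d a p V),
    h2, sub_eq_zero] at h1
  rw [sum₂_cons, h2, ← h1]
  module

/-- Summing the previous relation over the choice of `p` in `U` gives `n S = 2(n-1) S` with `n =
card U`, so `S = 0` unless `n = 2`. This is the constancy of `g(x,x)` along radial geodesics. -/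
theorem sum₂_eq_zero_of_three_le {U : Multiset ι} (hU : 3 ≤ Multiset.card U) : sum₂ d U = 0 := by
  have h1 : sum₁ (fun a V => sum₂ d (a ::ₘ V)) U =
      (2 * ((Multiset.card U : ℝ) - 1)) • sum₂ d U := by
    rw [sum₂, ← sum₁_smul]
    refine sum₁_congr fun a V hV => ?_
    rw [sum₂_cons_eq hd h, ← hV]
    simp
  rw [sum₁_const_cons, ← sub_eq_zero, ← sub_smul] at h1
  refine (smul_eq_zero.1 h1).resolve_left ?_
  have : (3 : ℝ) ≤ Multiset.card U := by exact_mod_cast hU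
  linarith

/-- The Gauss lemma `g_{pj}(x) x^j = g_{pj}(0) x^j` in Taylor coefficients; the coefficients of
degree one are excluded because they are the constants `g_{pj}(0)`. -/
theorem sum₁_eq_zero_of_two_le (p : ι) {U : Multiset ι} (hU : 2 ≤ Multiset.card U) :
    sum₁ (d p) U = 0 := by
  have h1 := sum₂_cons_eq hd h p U
  rw [sum₂_eq_zero_of_three_le hd h (by simpa using hU), eq_comm] at h1
  refine (smul_eq_zero.1 h1).resolve_left ?_
  have : (2 : ℝ) ≤ Multiset.card U := by exact_mod_cast hU
  linarith

end GaussLemma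

/-! ### The geodesic equation along straight lines and its Taylor coefficients -/

section Quadratic

variable {κ ν : Type} [Fintype κ] [DecidableEq κ] [Fintype ν] [DecidableEq ν]

theorem jet_sum_coord_mul_coord_mul (e : ν ↪ κ) {f : ν → ν → (κ → ℝ) → ℝ}
    (hf : ∀ a b, SmoothAt (f a b)) (T : Multiset κ) (hT : ∀ a, e a ∉ T) (U : Multiset ν) :
    jet (∑ a, (fun y => y (e a)) * ∑ b, (fun y => y (e b)) * f a b) (T + U.map e) =
      sum₂ (fun a b V => jet (f a b) (T + V.map e)) U := by
  rw [jet_sum_coord_mul e (fun a => SmoothAt.finsetSum fun b => (smoothAt_coord _).mul (hf a b))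
    T hT U, sum₂, sum₁]
  refine congrArg _ (Multiset.map_congr rfl fun a _ => ?_)
  rw [jet_sum_coord_mul e (hf a) T hT]
  rfl

/-- A straight line has zero acceleration, so only the Christoffel term remains. The equation at
time `1` suffices: letting the endpoint `w + v` vary gives an identity of functions near the origin.
-/
theorem IsGeodesicOn.of_linear {G : (κ → ℝ) → Matrix κ κ ℝ} {v w : κ → ℝ}
    (h : IsGeodesicOn G (fun t => w + t • v) (Set.Icc 0 1)) (hG : (G (w + v)).det ≠ 0) (p : κ) :
    ∑ j, ∑ m, v j * (v m * christoffelLow G p j m (w + v)) = 0 := by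
  have h1 := h.2 1 (by simp)
  have hderiv : ∀ (j : κ), deriv (fun r : ℝ => (w + r • v) j) = fun _ => v j := fun j => by
    ext r
    simp
  have h2 : ∀ i, ∑ j, ∑ m, christoffel G i j m (w + v) * v j * v m = 0 := fun i => by
    have := h1 i
    rw [iteratedDeriv_succ, iteratedDeriv_one] at this
    simp only [hderiv] at this
    simpa using this
  calc ∑ j, ∑ m, v j * (v m * christoffelLow G p j m (w + v))
      = ∑ j, ∑ m, ∑ i, G (w + v) p i * (christoffel G i j m (w + v) * v j * v m) := by
        refine Finset.sum_congr rfl fun j _ => Finset.sum_congr rfl fun m _ => ?_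
        rw [← sum_mul_christoffel hG, Finset.mul_sum, Finset.mul_sum]
        exact Finset.sum_congr rfl fun i _ => by ring
    _ = ∑ i, G (w + v) p i * ∑ j, ∑ m, christoffel G i j m (w + v) * v j * v m := by
        simp only [Finset.mul_sum]
        rw [Finset.sum_comm' (t' := Finset.univ) (s' := fun _ => Finset.univ) (by simp)]
        rw [Finset.sum_congr rfl fun m _ => Finset.sum_comm]
        rw [Finset.sum_comm]
        exact Finset.sum_congr rfl fun i _ => Finset.sum_comm
    _ = 0 := by simp [h2]

end Quadratic

/-! ### Metrics in submanifold geodesic normal coordinates -/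

section Admissible

open Filter

variable {k l : ℕ}

/-- The inclusion of the coordinate subspace `{u = 0}`. -/
noncomputable def tangentialInclusion (k l : ℕ) : (Fin k → ℝ) →L[ℝ] (Fin k ⊕ Fin l → ℝ) :=
  ContinuousLinearMap.pi (Sum.elim (fun α => ContinuousLinearMap.proj α) fun _ => 0)

theorem tangentialInclusion_apply (x : Fin k → ℝ) :
    tangentialInclusion k l x = Sum.elim x 0 := by
  ext i
  rcases i with i | i <;> simp [tangentialInclusion]

theorem tangentialInclusion_single (i : Fin k) :
    tangentialInclusion k l (Pi.single i 1) = Pi.single (Sum.inl i) 1 := by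
  rw [tangentialInclusion_apply]
  ext j
  rcases j with j | j <;> simp [Pi.single_apply]

theorem tendsto_sumElim_zero :
    Tendsto (fun x : Fin k → ℝ => (Sum.elim x 0 : Fin k ⊕ Fin l → ℝ)) (𝓝 0) (𝓝 0) := by
  have := (tangentialInclusion k l).continuous.tendsto 0
  rw [map_zero] at this
  exact this.congr tangentialInclusion_apply

variable (hT : Matrix (Fin k) (Fin k) ℝ) (hN : Matrix (Fin l) (Fin l) ℝ)

/-- The properties of the components of a metric in submanifold geodesic normal coordinates. -/
structure Admissible (G : (Fin k ⊕ Fin l → ℝ) → Matrix (Fin k ⊕ Fin l) (Fin k ⊕ Fin l) ℝ) :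
    Prop where
  smooth : ∀ i j, SmoothAt fun y => G y i j
  symm : ∀ y i j, G y i j = G y j i
  frame : G 0 = Matrix.fromBlocks hT 0 0 hN
  radial_geodesic : ∀ᶠ x in 𝓝 (0 : Fin k → ℝ),
    IsGeodesicOn (inducedMetric G) (fun t => t • x) (Set.Icc 0 1)
  normal : ∀ᶠ x in 𝓝 (0 : Fin k → ℝ), ∀ α α', G (Sum.elim x 0) (Sum.inl α) (Sum.inr α') = 0
  normal_parallel : ∀ᶠ x in 𝓝 (0 : Fin k → ℝ), ∀ t ∈ Set.Icc (0 : ℝ) 1, ∀ β' δ',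
    ∑ α, x α * normalConnection G δ' α β' (t • x) = 0
  normal_geodesic : ∀ᶠ y in 𝓝 (0 : Fin k ⊕ Fin l → ℝ),
    IsGeodesicOn G
      (fun t => Sum.elim (fun α => y (Sum.inl α)) (fun α' => t * y (Sum.inr α'))) (Set.Icc 0 1)

/-- The partial derivatives at the origin of the components of the metric. -/
noncomputable def metricJet (G : (Fin k ⊕ Fin l → ℝ) → Matrix (Fin k ⊕ Fin l) (Fin k ⊕ Fin l) ℝ)
    (i j : Fin k ⊕ Fin l) (T : Multiset (Fin k)) (U : Multiset (Fin l)) : ℝ :=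
  jet (fun y => G y i j) (T.map Sum.inl + U.map Sum.inr)

variable {hT hN} {G : (Fin k ⊕ Fin l → ℝ) → Matrix (Fin k ⊕ Fin l) (Fin k ⊕ Fin l) ℝ}

theorem jet_inl_cons (i j : Fin k ⊕ Fin l) (α : Fin k) (T : Multiset (Fin k))
    (U : Multiset (Fin l)) :
    jet (fun y => G y i j) (Sum.inl α ::ₘ (T.map Sum.inl + U.map Sum.inr)) =
      metricJet G i j (α ::ₘ T) U := by
  simp [metricJet]

theorem jet_inr_cons (i j : Fin k ⊕ Fin l) (α : Fin l) (T : Multiset (Fin k))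
    (U : Multiset (Fin l)) :
    jet (fun y => G y i j) (Sum.inr α ::ₘ (T.map Sum.inl + U.map Sum.inr)) =
      metricJet G i j T (α ::ₘ U) := by
  simp [metricJet]

theorem jet_eq_metricJet (i j : Fin k ⊕ Fin l) (T : Multiset (Fin k)) (U : Multiset (Fin l)) :
    jet (fun y => G y i j) (T.map Sum.inl + U.map Sum.inr) = metricJet G i j T U := rfl

theorem inducedMetric_eq_comp (α β : Fin k) :
    (fun x => inducedMetric G x α β) =
      (fun y => G y (Sum.inl α) (Sum.inl β)) ∘ tangentialInclusion k l := by
  ext x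
  simp [inducedMetric, tangentialInclusion_apply]

theorem det_frame_ne_zero (hT_det : hT.det ≠ 0) (hN_det : hN.det ≠ 0) :
    (Matrix.fromBlocks hT 0 0 hN).det ≠ 0 := by
  rw [Matrix.det_fromBlocks_zero₂₁]
  exact mul_ne_zero hT_det hN_det

theorem jet_comp_inclusion {f : (Fin k ⊕ Fin l → ℝ) → ℝ} (hf : SmoothAt f)
    (T : Multiset (Fin k)) : jet (f ∘ tangentialInclusion k l) T = jet f (T.map Sum.inl) :=
  jet_comp _ _ tangentialInclusion_single hf T

namespace Admissible

variable (hG : Admissible hT hN G)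
include hG

theorem inducedMetric_zero : inducedMetric G 0 = hT := by
  ext α β
  have : (Sum.elim 0 0 : Fin k ⊕ Fin l → ℝ) = 0 := by
    rw [← tangentialInclusion_apply, map_zero]
  rw [inducedMetric, this, hG.frame, Matrix.fromBlocks_apply₁₁]

theorem smooth_inducedMetric (α β : Fin k) : SmoothAt fun x => inducedMetric G x α β := by
  rw [inducedMetric_eq_comp]
  exact (hG.smooth _ _).comp_clm _

theorem jet_inducedMetric (α β : Fin k) (T : Multiset (Fin k)) :
    jet (fun x => inducedMetric G x α β) T = metricJet G (.inl α) (.inl β) T 0 := by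
  rw [inducedMetric_eq_comp, jet_comp_inclusion (hG.smooth _ _), metricJet]
  simp

theorem metricJet_symm (i j : Fin k ⊕ Fin l) (T : Multiset (Fin k)) (U : Multiset (Fin l)) :
    metricJet G i j T U = metricJet G j i T U := by
  simp only [metricJet, hG.symm _ i j]

theorem metricJet_inl_inr_zero (α : Fin k) (β' : Fin l) (T : Multiset (Fin k)) :
    metricJet G (.inl α) (.inr β') T 0 = 0 := by
  have h1 : (fun y => G y (Sum.inl α) (Sum.inr β')) ∘ tangentialInclusion k l =ᶠ[𝓝 0] 0 := by
    filter_upwards [hG.normal] with x hx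
    simp [tangentialInclusion_apply, hx]
  have h2 := jet_comp_inclusion (hG.smooth (.inl α) (.inr β')) T
  rw [jet_congr h1, jet_fun_zero] at h2
  rw [metricJet, h2]
  simp

section

variable (hT_det : hT.det ≠ 0)
include hT_det

theorem sum₁_metricJet_tangential (α : Fin k) {T : Multiset (Fin k)}
    (hcard : 2 ≤ Multiset.card T) :
    sum₁ (fun β V => metricJet G (.inl α) (.inl β) V 0) T = 0 := by
  have key : ∀ p : Fin k, (∑ a, (fun x : Fin k → ℝ => x (Function.Embedding.refl _ a)) *
      ∑ b, (fun x : Fin k → ℝ => x (Function.Embedding.refl _ b)) *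
        christoffelLow (inducedMetric G) p a b) =ᶠ[𝓝 0] 0 := fun p => by
    filter_upwards [hG.radial_geodesic, SmoothAt.eventually_det_ne_zero hG.smooth_inducedMetric
      (by rwa [hG.inducedMetric_zero])] with x h1 h2
    have := IsGeodesicOn.of_linear (w := 0) (v := x) (G := inducedMetric G) (by simpa using h1)
      (by simpa using h2) p
    simpa [Finset.mul_sum] using this
  refine sum₁_eq_zero_of_two_le (d := fun α β V => metricJet G (.inl α) (.inl β) V 0)
    (fun i j U => hG.metricJet_symm _ _ _ _) (fun p U => ?_) α hcard
  have h1 := jet_sum_coord_mul_coord_mul (Function.Embedding.refl (Fin k))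
    (fun a b => smoothAt_christoffelLow hG.smooth_inducedMetric p a b) 0 (by simp) U
  rw [jet_congr (key p), jet_fun_zero] at h1
  simp only [Function.Embedding.coe_refl, Multiset.map_id, zero_add,
    jet_christoffelLow hG.smooth_inducedMetric, hG.jet_inducedMetric, ← smul_eq_mul (a := (1/2 : ℝ))]
    at h1
  rw [sum₂_smul, eq_comm, smul_eq_zero] at h1
  exact h1.resolve_left (by norm_num)

variable (hN_det : hN.det ≠ 0)
include hN_det

theorem eventually_det_ne_zero : ∀ᶠ y in 𝓝 0, (G y).det ≠ 0 :=
  SmoothAt.eventually_det_ne_zero hG.smooth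
    (by rw [hG.frame]; exact det_frame_ne_zero hT_det hN_det)

/-- Taylor coefficients of `u^a u^b Γ_{p,ab}(x,u) = 0`. Tangential derivatives cannot hit the
factors `u`, so `T` is a mere parameter. -/
theorem sum₂_christoffelLow_normal (p : Fin k ⊕ Fin l) (T : Multiset (Fin k))
    (U : Multiset (Fin l)) :
    sum₂ (fun a b V => jet (christoffelLow G p (.inr a) (.inr b))
      (T.map Sum.inl + V.map Sum.inr)) U = 0 := by
  have key : (∑ a, (fun y : Fin k ⊕ Fin l → ℝ => y (Function.Embedding.inr a)) *
      ∑ b, (fun y : Fin k ⊕ Fin l → ℝ => y (Function.Embedding.inr b)) *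
        christoffelLow G p (.inr a) (.inr b)) =ᶠ[𝓝 0] 0 := by
    filter_upwards [hG.normal_geodesic, hG.eventually_det_ne_zero hT_det hN_det] with y h1 h2
    have hy : Sum.elim (fun α => y (Sum.inl α)) (0 : Fin l → ℝ) +
        Sum.elim (0 : Fin k → ℝ) (fun α => y (Sum.inr α)) = y := by
      ext i
      rcases i with i | i <;> simp
    have := IsGeodesicOn.of_linear (w := Sum.elim (fun α => y (Sum.inl α)) (0 : Fin l → ℝ))
      (v := Sum.elim (0 : Fin k → ℝ) fun α => y (Sum.inr α)) (G := G) (by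
        convert h1 using 2 with t
        ext i
        rcases i with i | i <;> simp) (by rwa [hy]) p
    rw [hy] at this
    simpa [Finset.mul_sum, Fintype.sum_sum_type] using this
  have h1 := jet_sum_coord_mul_coord_mul (Function.Embedding.inr (α := Fin k) (β := Fin l))
    (fun a b => smoothAt_christoffelLow hG.smooth p (.inr a) (.inr b)) (T.map Sum.inl) (by simp) U
  rw [jet_congr key, jet_fun_zero] at h1
  exact h1.symm

theorem sum₁_christoffelLow_mixed (β' γ' : Fin l) (T : Multiset (Fin k)) :
    sum₁ (fun a V => jet (christoffelLow G (.inr γ') (.inl a) (.inr β')) (V.map Sum.inl)) T = 0 := by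
  have key : (∑ a, (fun x : Fin k → ℝ => x (Function.Embedding.refl _ a)) *
      (christoffelLow G (.inr γ') (.inl a) (.inr β') ∘ tangentialInclusion k l)) =ᶠ[𝓝 0] 0 := by
    filter_upwards [hG.normal_parallel, hG.normal,
      tendsto_sumElim_zero.eventually (hG.eventually_det_ne_zero hT_det hN_det)] with x h1 h2 h3
    have h4 := fun δ' => h1 1 (by simp) β' δ'
    simp only [one_smul, normalConnection] at h4
    -- Since `g_{αβ'} = 0` on `Σ`, lowering a normal index involves only the normal connection
    -- coefficients.
    have h5 : ∀ a, christoffelLow G (.inr γ') (.inl a) (.inr β') (Sum.elim x 0) =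
        ∑ δ', G (Sum.elim x 0) (.inr γ') (.inr δ') *
          christoffel G (.inr δ') (.inl a) (.inr β') (Sum.elim x 0) := fun a => by
      rw [← sum_mul_christoffel h3, Fintype.sum_sum_type]
      simp [hG.symm _ (.inr γ') (.inl _), h2]
    simp only [Finset.sum_apply, Pi.mul_apply, Function.comp, tangentialInclusion_apply, h5,
      Function.Embedding.refl_apply, Finset.mul_sum, Pi.zero_apply]
    rw [Finset.sum_comm]
    refine Finset.sum_eq_zero fun δ' _ => ?_
    rw [← mul_zero (G (Sum.elim x 0) (.inr γ') (.inr δ')), ← h4 δ', Finset.mul_sum]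
    exact Finset.sum_congr rfl fun a _ => by ring
  have h1 := jet_sum_coord_mul (Function.Embedding.refl (Fin k))
    (fun a => (smoothAt_christoffelLow hG.smooth (.inr γ') (.inl a) (.inr β')).comp_clm
      (tangentialInclusion k l)) 0 (by simp) T
  rw [jet_congr key, jet_fun_zero] at h1
  simp only [Function.Embedding.coe_refl, Multiset.map_id, zero_add,
    jet_comp_inclusion (smoothAt_christoffelLow hG.smooth _ _ _)] at h1
  exact h1.symm

theorem sum₁_metricJet_mixed (β' γ' : Fin l) (T : Multiset (Fin k)) :
    sum₁ (fun a V => metricJet G (.inr β') (.inr γ') (a ::ₘ V) 0 +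
      metricJet G (.inl a) (.inr γ') V {β'} - metricJet G (.inl a) (.inr β') V {γ'}) T = 0 := by
  have h1 := hG.sum₁_christoffelLow_mixed hT_det hN_det β' γ' T
  have h2 : ∀ (i j : Fin k ⊕ Fin l) (V : Multiset (Fin k)) (b : Fin l),
      jet (fun y => G y i j) (.inr b ::ₘ V.map Sum.inl) = metricJet G i j V {b} := fun i j V b => by
    rw [metricJet, Multiset.map_singleton, add_comm, Multiset.singleton_add]
  have h3 : ∀ (i j : Fin k ⊕ Fin l) (V : Multiset (Fin k)) (a : Fin k),
      jet (fun y => G y i j) (.inl a ::ₘ V.map Sum.inl) = metricJet G i j (a ::ₘ V) 0 :=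
    fun i j V a => by simp [metricJet]
  simp only [jet_christoffelLow hG.smooth, h2, h3, ← smul_eq_mul (a := (1/2 : ℝ))] at h1
  rw [sum₁_smul, smul_eq_zero] at h1
  exact h1.resolve_left (by norm_num)

/-- A parallel normal frame has constant inner products: adding the parallelism relations for `(β',
γ')` and `(γ', β')` cancels the mixed components. -/
theorem metricJet_inr_inr_zero (β' γ' : Fin l) {T : Multiset (Fin k)} (hT' : T ≠ 0) :
    metricJet G (.inr β') (.inr γ') T 0 = 0 := by
  have h1 := hG.sum₁_metricJet_mixed hT_det hN_det β' γ' T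
  have h2 := hG.sum₁_metricJet_mixed hT_det hN_det γ' β' T
  simp only [hG.metricJet_symm (.inr γ') (.inr β')] at h2
  rw [sum₁_sub, sum₁_add, sum₁_const_cons (fun V => metricJet G (.inr β') (.inr γ') V 0)] at h1 h2
  have h3 : (Multiset.card T : ℝ) * metricJet G (.inr β') (.inr γ') T 0 = 0 := by
    simp only [smul_eq_mul] at h1 h2
    linarith
  refine (mul_eq_zero.1 h3).resolve_left ?_
  exact_mod_cast fun h => hT' (Multiset.card_eq_zero.1 h)

theorem sum₂_metricJet_normal (p : Fin k ⊕ Fin l) (T : Multiset (Fin k)) (U : Multiset (Fin l)) :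
    sum₂ (fun a b V => metricJet G (.inr b) p T (a ::ₘ V) + metricJet G (.inr a) p T (b ::ₘ V) -
      jet (fun y => G y (.inr a) (.inr b)) (p ::ₘ (T.map Sum.inl + V.map Sum.inr))) U = 0 := by
  have h1 := hG.sum₂_christoffelLow_normal hT_det hN_det p T U
  simp only [jet_christoffelLow hG.smooth, jet_inr_cons, ← smul_eq_mul (a := (1/2 : ℝ))] at h1
  rw [sum₂_smul, smul_eq_zero] at h1
  exact h1.resolve_left (by norm_num)

/-- The Gauss lemma along the normal geodesics. When `card U < 2` and `T ≠ 0`, constancy of the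
normal frame's inner products on `Σ` replaces it. -/
theorem sum₁_metricJet_inr (p : Fin l) {T : Multiset (Fin k)} {U : Multiset (Fin l)}
    (hTU : T ≠ 0 ∨ 2 ≤ Multiset.card U) :
    sum₁ (fun b V => metricJet G (.inr p) (.inr b) T V) U = 0 := by
  by_cases hU : 2 ≤ Multiset.card U
  · refine sum₁_eq_zero_of_two_le (d := fun a b V => metricJet G (.inr a) (.inr b) T V)
      (fun i j U => hG.metricJet_symm _ _ _ _) (fun p U => ?_) p hU
    simpa only [jet_inr_cons] using hG.sum₂_metricJet_normal hT_det hN_det (.inr p) T U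
  · refine sum₁_eq_zero fun a V hV => ?_
    have : V = 0 := by
      rw [← hV, Multiset.card_cons] at hU
      exact Multiset.card_eq_zero.1 (by omega)
    rw [this]
    exact hG.metricJet_inr_inr_zero hT_det hN_det _ _ (hTU.resolve_right hU)

/-- Normal geodesics stay orthogonal to the slices of constant `u`-distance: `g_{αb'} u^{b'} = 0`.
In the geodesic relation with tangential `p = α`, the term `∂_α g_{a'b'}` drops out by the normal
Gauss lemma, leaving `2(card U - 1)` times the sum. -/
theorem sum₁_metricJet_inl (α : Fin k) (T : Multiset (Fin k)) (U : Multiset (Fin l)) :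
    sum₁ (fun b V => metricJet G (.inl α) (.inr b) T V) U = 0 := by
  by_cases hU : 2 ≤ Multiset.card U
  · have h1 := hG.sum₂_metricJet_normal hT_det hN_det (.inl α) T U
    simp only [jet_inl_cons, hG.metricJet_symm _ (.inl α)] at h1
    rw [sum₂_sub, sum₂_add, sum₂_left (fun a V => metricJet G (.inl α) (.inr a) T V),
      sum₂_right (fun a V => metricJet G (.inl α) (.inr a) T V)] at h1
    have h2 : sum₂ (fun a b V => metricJet G (.inr a) (.inr b) (α ::ₘ T) V) U = 0 :=
      sum₁_eq_zero fun a V _ => hG.sum₁_metricJet_inr hT_det hN_det a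
        (.inl (Multiset.cons_ne_zero))
    rw [h2, sub_zero, ← two_smul ℝ, smul_smul] at h1
    refine (smul_eq_zero.1 h1).resolve_left ?_
    have : (2 : ℝ) ≤ Multiset.card U := by exact_mod_cast hU
    linarith
  · refine sum₁_eq_zero fun a V hV => ?_
    have : V = 0 := by
      rw [← hV, Multiset.card_cons] at hU
      exact Multiset.card_eq_zero.1 (by omega)
    rw [this]
    exact hG.metricJet_inl_inr_zero _ _ _

theorem metricJet_inl_inr_antisymm (α : Fin k) (β' γ' : Fin l) (T : Multiset (Fin k)) :
    metricJet G (.inl α) (.inr γ') T {β'} = -metricJet G (.inl α) (.inr β') T {γ'} := by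
  have := hG.sum₁_metricJet_inl hT_det hN_det α T (β' ::ₘ γ' ::ₘ 0)
  rw [sum₁_cons, sum₁_cons, sum₁_empty] at this
  simp only [Multiset.cons_zero] at this
  linarith

/-- What parallelism leaves once the inner products of the normal frame are constant: the two mixed
terms agree by antisymmetry in `β'`, `γ'`. -/
theorem sum₁_metricJet_inl_inr (β' γ' : Fin l) (T : Multiset (Fin k)) :
    sum₁ (fun a V => metricJet G (.inl a) (.inr β') V {γ'}) T = 0 := by
  have h1 := hG.sum₁_metricJet_mixed hT_det hN_det β' γ' T
  rw [sum₁_congr (ψ := fun a V => (-2 : ℝ) • metricJet G (.inl a) (.inr β') V {γ'})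
    fun a V _ => ?_, sum₁_smul, smul_eq_zero] at h1
  · exact h1.resolve_left (by norm_num)
  · rw [hG.metricJet_inr_inr_zero hT_det hN_det _ _ (Multiset.cons_ne_zero),
      hG.metricJet_inl_inr_antisymm hT_det hN_det, smul_eq_mul]
    ring

/-- Symmetric in the first two indices and, by the Gauss relation, antisymmetric in the last two,
hence zero. -/
theorem metricJet_inr_inr_singleton (β' γ' δ' : Fin l) (T : Multiset (Fin k)) :
    metricJet G (.inr β') (.inr γ') T {δ'} = 0 := by
  have key : ∀ a b c, metricJet G (.inr a) (.inr b) T {c} +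
      metricJet G (.inr a) (.inr c) T {b} = 0 := fun a b c => by
    have := hG.sum₁_metricJet_inr hT_det hN_det a (T := T) (U := b ::ₘ c ::ₘ 0) (.inr (by simp))
    rw [sum₁_cons, sum₁_cons, sum₁_empty] at this
    simpa only [Multiset.cons_zero, add_zero] using this
  have h1 := key β' γ' δ'
  have h2 := key γ' δ' β'
  have h3 := key δ' β' γ'
  rw [hG.metricJet_symm (.inr γ') (.inr β')] at h2
  rw [hG.metricJet_symm (.inr δ') (.inr β'), hG.metricJet_symm (.inr δ') (.inr γ')] at h3
  linarith

end

end Admissible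

end Admissible

/-! ### The second fundamental form -/

section SecondFundamentalForm

open Filter

variable {k l : ℕ} {hT : Matrix (Fin k) (Fin k) ℝ} {hN : Matrix (Fin l) (Fin l) ℝ}

theorem secondFundamentalForm_eventuallyEq
    {G : (Fin k ⊕ Fin l → ℝ) → Matrix (Fin k ⊕ Fin l) (Fin k ⊕ Fin l) ℝ}
    (hG : Admissible hT hN G) (hT_det : hT.det ≠ 0) (hN_det : hN.det ≠ 0) (a : Fin 2 → Fin k)
    (ν : Fin l) : secondFundamentalForm G a ν =ᶠ[𝓝 0]
      christoffelLow G (.inr ν) (.inl (a 0)) (.inl (a 1)) ∘ tangentialInclusion k l := by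
  filter_upwards [tendsto_sumElim_zero.eventually (hG.eventually_det_ne_zero hT_det hN_det)]
    with x hx
  rw [Function.comp, tangentialInclusion_apply, ← sum_mul_christoffel hx]
  exact Finset.sum_congr rfl fun s _ => by rw [hG.symm]

theorem smoothAt_secondFundamentalForm
    {G : (Fin k ⊕ Fin l → ℝ) → Matrix (Fin k ⊕ Fin l) (Fin k ⊕ Fin l) ℝ}
    (hG : Admissible hT hN G) (hT_det : hT.det ≠ 0) (hN_det : hN.det ≠ 0) (a : Fin 2 → Fin k)
    (ν : Fin l) : SmoothAt (secondFundamentalForm G a ν) :=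
  ((smoothAt_christoffelLow hG.smooth _ _ _).comp_clm _).congr
    (secondFundamentalForm_eventuallyEq hG hT_det hN_det a ν)

/-- On `Σ` the lowered component is `Γ_{ν,αβ}`. Its terms `∂_α g_{βν}` and `∂_β g_{αν}` are
tangential derivatives of functions vanishing on `Σ`. -/
theorem jet_secondFundamentalForm
    {G : (Fin k ⊕ Fin l → ℝ) → Matrix (Fin k ⊕ Fin l) (Fin k ⊕ Fin l) ℝ}
    (hG : Admissible hT hN G) (hT_det : hT.det ≠ 0) (hN_det : hN.det ≠ 0) (a : Fin 2 → Fin k)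
    (ν : Fin l) (T : Multiset (Fin k)) : jet (secondFundamentalForm G a ν) T =
      -(1 / 2) * metricJet G (.inl (a 0)) (.inl (a 1)) T {ν} := by
  have h1 : ∀ (i j : Fin k ⊕ Fin l) (b : Fin k), jet (fun y => G y i j) (.inl b ::ₘ T.map Sum.inl) =
      metricJet G i j (b ::ₘ T) 0 := fun i j b => by simp [metricJet]
  have h2 : ∀ (i j : Fin k ⊕ Fin l), jet (fun y => G y i j) (.inr ν ::ₘ T.map Sum.inl) =
      metricJet G i j T {ν} := fun i j => by
    rw [metricJet, Multiset.map_singleton, add_comm, Multiset.singleton_add]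
  rw [jet_congr (secondFundamentalForm_eventuallyEq hG hT_det hN_det a ν),
    jet_comp_inclusion (smoothAt_christoffelLow hG.smooth _ _ _),
    jet_christoffelLow hG.smooth, h1, h1, h2, hG.metricJet_inl_inr_zero,
    hG.metricJet_inl_inr_zero]
  ring

variable {V : Type*} {Ω : Type*} {val : Ω → V → ℝ} {s : ℕ}
  {G : Ω → (Fin k ⊕ Fin l → ℝ) → Matrix (Fin k ⊕ Fin l) (Fin k ⊕ Fin l) ℝ}
  (hG : ∀ A, Admissible hT hN (G A)) (hT_det : hT.det ≠ 0) (hN_det : hN.det ≠ 0)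
  (hs : ∀ i j m, (fun A => pd (fun y => G A y i j) m) ∈ jetOrder val 1 s)
include hG hT_det hs

theorem christoffel_inducedMetric_mem (i j m : Fin k) :
    (fun A => christoffel (inducedMetric (G A)) i j m) ∈ jetOrder val 1 s := by
  refine christoffel_mem_jetOrder (G := fun A => inducedMetric (G A))
    (fun A => (hG A).smooth_inducedMetric) (fun A => (hG A).inducedMetric_zero) (fun i j m => ?_)
    hT_det i j m
  refine jetOrder_congr (comp_mem_jetOrder (tangentialInclusion k l) _ tangentialInclusion_single
    (hs (.inl i) (.inl j) (.inl m))) fun A => ?_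
  rw [inducedMetric_eq_comp]
  exact pd_comp _ _ tangentialInclusion_single ((hG A).smooth _ _) m

include hN_det

theorem normalConnection_mem (δ' : Fin l) (α : Fin k) (β' : Fin l) :
    (fun A => normalConnection (G A) δ' α β') ∈ jetOrder val 1 s := by
  refine jetOrder_congr (comp_mem_jetOrder (tangentialInclusion k l) _ tangentialInclusion_single
    (christoffel_mem_jetOrder (fun A => (hG A).smooth) (fun A => (hG A).frame) hs
      (det_frame_ne_zero hT_det hN_det) (.inr δ') (.inl α) (.inr β')))
    fun A => Eventually.of_forall fun x => ?_
  simp [normalConnection, tangentialInclusion_apply]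

theorem smoothAt_nablaSecondFundamentalForm (m : ℕ) (a : Fin 2 → Fin k) (ν : Fin l)
    (c : Fin m → Fin k) (A : Ω) : SmoothAt (nablaSecondFundamentalForm (G A) m a ν c) := by
  have hΓ := fun i j m => (christoffel_inducedMetric_mem hG hT_det hs i j m).1 A
  have hΔ := fun i j m => (normalConnection_mem hG hT_det hN_det hs i j m).1 A
  induction m generalizing a ν with
  | zero => exact smoothAt_secondFundamentalForm (hG A) hT_det hN_det a ν
  | succ m ih =>
    exact ((((ih _ _ _).pd _).sub (ContDiffAt.sum fun i _ => ContDiffAt.sum fun p _ =>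
      (hΓ _ _ _).mul (ih _ _ _))).sub (ContDiffAt.sum fun i _ => ContDiffAt.sum fun p _ =>
      (hΓ _ _ _).mul (ih _ _ _))).sub (ContDiffAt.sum fun p _ => (hΔ _ _ _).mul (ih _ _ _))

theorem pd_sub_nablaSecondFundamentalForm_mem (t : ℕ) (ht : t ≤ s)
    (H : ∀ m (a : (Fin 2 → Fin k) × Fin l) c,
      (fun A => nablaSecondFundamentalForm (G A) m a.1 a.2 c) ∈ jetOrder val 1 t) (m : ℕ)
    (a : (Fin 2 → Fin k) × Fin l) (c : Fin (m + 1) → Fin k) :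
    (fun A => pd (nablaSecondFundamentalForm (G A) m a.1 a.2 fun i => c i.castSucc)
      (c (Fin.last m)) - nablaSecondFundamentalForm (G A) (m + 1) a.1 a.2 c) ∈
      jetOrder val 2 t := by
  have hΓ := fun i j m => jetOrder_mono le_rfl ht (christoffel_inducedMetric_mem hG hT_det hs i j m)
  have hΔ := fun i j m => jetOrder_mono le_rfl ht (normalConnection_mem hG hT_det hN_det hs i j m)
  have : (fun A => pd (nablaSecondFundamentalForm (G A) m a.1 a.2 fun i => c i.castSucc)
      (c (Fin.last m)) - nablaSecondFundamentalForm (G A) (m + 1) a.1 a.2 c) =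
      (∑ i : Fin 2, ∑ p, (fun A => christoffel (inducedMetric (G A)) p (c (Fin.last m)) (a.1 i)) *
        fun A => nablaSecondFundamentalForm (G A) m (Function.update a.1 i p) a.2
          (fun t => c t.castSucc)) +
      (∑ i : Fin m, ∑ p,
        (fun A => christoffel (inducedMetric (G A)) p (c (Fin.last m)) (c i.castSucc)) *
        fun A => nablaSecondFundamentalForm (G A) m a.1 a.2
          (Function.update (fun t => c t.castSucc) i p)) +
      ∑ δ', (fun A => normalConnection (G A) δ' (c (Fin.last m)) a.2) *
        fun A => nablaSecondFundamentalForm (G A) m a.1 δ' (fun t => c t.castSucc) := by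
    ext A y
    simp only [nablaSecondFundamentalForm, Pi.add_apply, Pi.sub_apply, Pi.mul_apply,
      Finset.sum_apply]
    ring
  rw [this]
  exact Submodule.add_mem _ (Submodule.add_mem _
    (Submodule.sum_mem _ fun i _ => Submodule.sum_mem _ fun p _ =>
      mul_mem_jetOrder (hΓ _ _ _) (H _ (_, _) _))
    (Submodule.sum_mem _ fun i _ => Submodule.sum_mem _ fun p _ =>
      mul_mem_jetOrder (hΓ _ _ _) (H _ (_, _) _)))
    (Submodule.sum_mem _ fun p _ =>
      mul_mem_jetOrder (hΔ p (c (Fin.last m)) a.2) (H m (a.1, p) fun t => c t.castSucc))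

variable (hval : ∀ m a ν c, (fun A => nablaSecondFundamentalForm (G A) m a ν c 0) ∈
  polyOrder val 1)
include hval

theorem secondFundamentalForm_mem_jetOrder (a : Fin 2 → Fin k) (ν : Fin l) :
    (fun A => secondFundamentalForm (G A) a ν) ∈ jetOrder val 1 (s + 1) :=
  covariant_mem_jetOrder (I := (Fin 2 → Fin k) × Fin l)
    (F := fun m a c A => nablaSecondFundamentalForm (G A) m a.1 a.2 c)
    (fun m a c A => smoothAt_nablaSecondFundamentalForm hG hT_det hN_det hs m a.1 a.2 c A)
    (fun m a c => hval m a.1 a.2 c)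
    (pd_sub_nablaSecondFundamentalForm_mem hG hT_det hN_det hs) le_rfl 0 (a, ν) Fin.elim0

theorem nablaSecondFundamentalForm_sub_jet_mem (m : ℕ) (hm : m ≤ s + 1) (a : Fin 2 → Fin k)
    (ν : Fin l) (c : Fin m → Fin k) :
    (fun A => nablaSecondFundamentalForm (G A) m a ν c 0 -
      jet (secondFundamentalForm (G A) a ν) (mset c)) ∈ polyOrder val 2 := by
  have := covariant_jet_sub_mem (I := (Fin 2 → Fin k) × Fin l)
    (F := fun m a c A => nablaSecondFundamentalForm (G A) m a.1 a.2 c)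
    (fun m a c A => smoothAt_nablaSecondFundamentalForm hG hT_det hN_det hs m a.1 a.2 c A)
    (fun m a c => hval m a.1 a.2 c)
    (pd_sub_nablaSecondFundamentalForm_mem hG hT_det hN_det hs) m (a, ν) c 0 (by simpa using hm)
  simp only [jet_zero, add_zero] at this
  exact this

end SecondFundamentalForm

/-! ### The metric in terms of curvature, modulo quadratic terms -/

section Formulas

open Filter

variable {k l : ℕ} (hT : Matrix (Fin k) (Fin k) ℝ) (hN : Matrix (Fin l) (Fin l) ℝ)

/-- The metrics in submanifold geodesic normal coordinates. -/
abbrev AdmissibleMetric : Type :=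
  {G : (Fin k ⊕ Fin l → ℝ) → Matrix (Fin k ⊕ Fin l) (Fin k ⊕ Fin l) ℝ // Admissible hT hN G}

/-- The components of the covariant derivatives of the curvature and the second fundamental form. -/
noncomputable def jetVals (A : AdmissibleMetric hT hN) : JetVar k l → ℝ := jetVal A.1

/-- Functions of the metric modulo polynomials in the jet variables with all terms of degree at
least two. -/
abbrev JetQuotient : Type := (AdmissibleMetric hT hN → ℝ) ⧸ polyOrder (jetVals hT hN) 2

/-- The class of a function modulo quadratic terms. -/
noncomputable abbrev toQuotient : (AdmissibleMetric hT hN → ℝ) →ₗ[ℝ] JetQuotient hT hN :=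
  (polyOrder (jetVals hT hN) 2).mkQ

/-- The class of a partial derivative of a metric component. -/
noncomputable def metricClass (i j : Fin k ⊕ Fin l) (T : Multiset (Fin k)) (U : Multiset (Fin l)) :
    JetQuotient hT hN := toQuotient hT hN fun A => metricJet A.1 i j T U

/-- The class of a partial derivative of a curvature component. -/
noncomputable def curvatureClass (a : Fin 4 → Fin k ⊕ Fin l) (c : Multiset (Fin k ⊕ Fin l)) :
    JetQuotient hT hN := toQuotient hT hN fun A => jet (curvature A.1 a) c

/-- The class of a partial derivative of a component of the second fundamental form. -/
noncomputable def sffClass (a : Fin 2 → Fin k) (ν : Fin l) (c : Multiset (Fin k)) :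
    JetQuotient hT hN := toQuotient hT hN fun A => jet (secondFundamentalForm A.1 a ν) c

/-- The classes of polynomials without constant term. -/
noncomputable def positiveClasses : Submodule ℝ (JetQuotient hT hN) :=
  (polyOrder (jetVals hT hN) 1).map (toQuotient hT hN)

variable {hT hN}

theorem toQuotient_eq_iff {f g : AdmissibleMetric hT hN → ℝ} :
    toQuotient hT hN f = toQuotient hT hN g ↔ f - g ∈ polyOrder (jetVals hT hN) 2 :=
  Submodule.Quotient.eq _

/-- Changing a representative adds an element of `polyOrder 2`, which is contained in `polyOrder 1`.
-/
theorem toQuotient_mem_iff {f : AdmissibleMetric hT hN → ℝ} :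
    toQuotient hT hN f ∈ positiveClasses hT hN ↔ f ∈ polyOrder (jetVals hT hN) 1 := by
  refine ⟨fun ⟨g, hg, h⟩ => ?_, fun h => ⟨f, h, rfl⟩⟩
  have := polyOrder_mono one_le_two (toQuotient_eq_iff.1 h)
  simpa using Submodule.sub_mem _ hg this

theorem sum₁_toQuotient_eq_zero {ι : Type*} [DecidableEq ι]
    {φ : AdmissibleMetric hT hN → ι → Multiset ι → ℝ} {U : Multiset ι}
    (h : ∀ A, sum₁ (φ A) U = 0) :
    sum₁ (fun a V => toQuotient hT hN fun A => φ A a V) U = 0 := by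
  have h1 := map_sum₁ (toQuotient hT hN).toAddMonoidHom (fun a V A => φ A a V) U
  simp only [LinearMap.toAddMonoidHom_coe] at h1
  rw [← h1]
  convert map_zero (toQuotient hT hN)
  ext A
  have := map_sum₁ (Pi.evalAddMonoidHom (fun _ : AdmissibleMetric hT hN => ℝ) A)
    (fun a V A => φ A a V) U
  simpa [h A] using this

theorem toQuotient_half (f g h e : AdmissibleMetric hT hN → ℝ) :
    (toQuotient hT hN fun A => 1 / 2 * (f A - g A - h A + e A)) = (1 / 2 : ℝ) •
      (toQuotient hT hN f - toQuotient hT hN g - toQuotient hT hN h + toQuotient hT hN e) := by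
  rw [← map_sub, ← map_sub, ← map_add, ← map_smul]
  rfl

theorem inl_cons (α : Fin k) (T : Multiset (Fin k)) (U : Multiset (Fin l)) :
    (Sum.inl α ::ₘ (T.map Sum.inl + U.map Sum.inr) : Multiset (Fin k ⊕ Fin l)) =
      (α ::ₘ T).map Sum.inl + U.map Sum.inr := by simp

theorem inr_cons (α : Fin l) (T : Multiset (Fin k)) (U : Multiset (Fin l)) :
    (Sum.inr α ::ₘ (T.map Sum.inl + U.map Sum.inr) : Multiset (Fin k ⊕ Fin l)) =
      T.map Sum.inl + (α ::ₘ U).map Sum.inr := by simp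

theorem exists_eq_map_add_map (c : Multiset (Fin k ⊕ Fin l)) :
    ∃ (T : Multiset (Fin k)) (U : Multiset (Fin l)), c = T.map Sum.inl + U.map Sum.inr := by
  induction c using Multiset.induction with
  | empty => exact ⟨0, 0, by simp⟩
  | cons i c ih =>
    obtain ⟨T, U, rfl⟩ := ih
    rcases i with α | α
    exacts [⟨_, _, inl_cons α T U⟩, ⟨_, _, inr_cons α T U⟩]

theorem sum₁_mem {ι W : Type*} [DecidableEq ι] [AddCommGroup W] [Module ℝ W] (S : Submodule ℝ W)
    {φ : ι → Multiset ι → W} {U : Multiset ι} (h : ∀ a V, a ::ₘ V = U → φ a V ∈ S) :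
    sum₁ φ U ∈ S := by
  refine multiset_sum_mem _ fun w hw => ?_
  obtain ⟨a, ha, rfl⟩ := Multiset.mem_map.1 hw
  exact h a _ (Multiset.cons_erase ha)

theorem sum₂_mem {ι W : Type*} [DecidableEq ι] [AddCommGroup W] [Module ℝ W] (S : Submodule ℝ W)
    {φ : ι → ι → Multiset ι → W} {U : Multiset ι}
    (h : ∀ a b V, a ::ₘ b ::ₘ V = U → φ a b V ∈ S) : sum₂ φ U ∈ S :=
  sum₁_mem S fun a V hV => sum₁_mem S fun b V' hV' => h a b V' (by rw [hV', hV])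

theorem metricClass_symm (i j : Fin k ⊕ Fin l) (T : Multiset (Fin k)) (U : Multiset (Fin l)) :
    metricClass hT hN i j T U = metricClass hT hN j i T U := by
  simp only [metricClass, fun A : AdmissibleMetric hT hN => A.2.metricJet_symm i j]

theorem metricClass_inl_inr_zero (α : Fin k) (β' : Fin l) (T : Multiset (Fin k)) :
    metricClass hT hN (.inl α) (.inr β') T 0 = 0 := by
  simp only [metricClass, fun A : AdmissibleMetric hT hN => A.2.metricJet_inl_inr_zero α β' T]
  exact map_zero _

section

variable (hT_det : hT.det ≠ 0)
include hT_det

theorem metricClass_inl_inl_singleton (α β γ : Fin k) :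
    metricClass hT hN (.inl α) (.inl β) {γ} 0 = 0 := by
  have h : ∀ A : AdmissibleMetric hT hN, metricJet A.1 (.inl α) (.inl β) {γ} 0 = 0 := fun A => by
    have key : ∀ a b c, metricJet A.1 (.inl a) (.inl b) {c} 0 +
        metricJet A.1 (.inl a) (.inl c) {b} 0 = 0 := fun a b c => by
      have := A.2.sum₁_metricJet_tangential hT_det a (T := b ::ₘ c ::ₘ 0) (by simp)
      rw [sum₁_cons, sum₁_cons, sum₁_empty] at this
      simpa only [Multiset.cons_zero, add_zero] using this
    have h1 := key α β γ
    have h2 := key β γ α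
    have h3 := key γ α β
    rw [A.2.metricJet_symm (.inl β) (.inl α)] at h2
    rw [A.2.metricJet_symm (.inl γ) (.inl α), A.2.metricJet_symm (.inl γ) (.inl β)] at h3
    linarith
  simp only [metricClass, h]
  exact map_zero _

theorem sum₁_metricClass_tangential (α : Fin k) {T : Multiset (Fin k)}
    (hcard : 2 ≤ Multiset.card T) :
    sum₁ (fun β V => metricClass hT hN (.inl α) (.inl β) V 0) T = 0 :=
  sum₁_toQuotient_eq_zero fun A => A.2.sum₁_metricJet_tangential hT_det α hcard

variable (hN_det : hN.det ≠ 0)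
include hN_det

theorem sum₁_metricClass_inr (p : Fin l) {T : Multiset (Fin k)} {U : Multiset (Fin l)}
    (hTU : T ≠ 0 ∨ 2 ≤ Multiset.card U) :
    sum₁ (fun b V => metricClass hT hN (.inr p) (.inr b) T V) U = 0 :=
  sum₁_toQuotient_eq_zero fun A => A.2.sum₁_metricJet_inr hT_det hN_det p hTU

theorem sum₁_metricClass_inl (α : Fin k) (T : Multiset (Fin k)) (U : Multiset (Fin l)) :
    sum₁ (fun b V => metricClass hT hN (.inl α) (.inr b) T V) U = 0 :=
  sum₁_toQuotient_eq_zero fun A => A.2.sum₁_metricJet_inl hT_det hN_det α T U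

theorem sum₁_metricClass_inl_inr (β' γ' : Fin l) (T : Multiset (Fin k)) :
    sum₁ (fun a V => metricClass hT hN (.inl a) (.inr β') V {γ'}) T = 0 :=
  sum₁_toQuotient_eq_zero fun A => A.2.sum₁_metricJet_inl_inr hT_det hN_det β' γ' T

theorem metricClass_inl_inr_antisymm (α : Fin k) (β' γ' : Fin l) (T : Multiset (Fin k)) :
    metricClass hT hN (.inl α) (.inr γ') T {β'} = -metricClass hT hN (.inl α) (.inr β') T {γ'} := by
  simp only [metricClass,
    fun A : AdmissibleMetric hT hN => A.2.metricJet_inl_inr_antisymm hT_det hN_det α β' γ' T]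
  exact map_neg (toQuotient hT hN) _

theorem metricClass_inr_inr_zero (β' γ' : Fin l) {T : Multiset (Fin k)} (hT' : T ≠ 0) :
    metricClass hT hN (.inr β') (.inr γ') T 0 = 0 := by
  simp only [metricClass,
    fun A : AdmissibleMetric hT hN => A.2.metricJet_inr_inr_zero hT_det hN_det β' γ' hT']
  exact map_zero _

theorem metricClass_inr_inr_singleton (β' γ' δ' : Fin l) (T : Multiset (Fin k)) :
    metricClass hT hN (.inr β') (.inr γ') T {δ'} = 0 := by
  simp only [metricClass,
    fun A : AdmissibleMetric hT hN => A.2.metricJet_inr_inr_singleton hT_det hN_det β' γ' δ' T]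
  exact map_zero _

theorem sffClass_eq (a : Fin 2 → Fin k) (ν : Fin l) (T : Multiset (Fin k)) :
    sffClass hT hN a ν T = -(1 / 2 : ℝ) • metricClass hT hN (.inl (a 0)) (.inl (a 1)) T {ν} := by
  simp only [sffClass, metricClass,
    fun A : AdmissibleMetric hT hN => jet_secondFundamentalForm A.2 hT_det hN_det a ν T]
  rw [← map_smul]
  rfl

variable {n : ℕ} (hlin : ∀ a (c : Multiset (Fin k ⊕ Fin l)), Multiset.card c + 1 ≤ n →
  curvatureClass hT hN a c = toQuotient hT hN fun A => jet (linCurvature A.1 a) c)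
include hlin

omit hN_det in
theorem sum₂_curvatureClass_tangential (α β : Fin k) {T : Multiset (Fin k)}
    (hcard : 2 ≤ Multiset.card T) (hn : Multiset.card T ≤ n + 1) :
    sum₂ (fun a b V => curvatureClass hT hN ![.inl α, .inl a, .inl b, .inl β] (V.map Sum.inl)) T =
      ((1 / 2 : ℝ) * Multiset.card T * (Multiset.card T + 1)) •
        metricClass hT hN (.inl α) (.inl β) T 0 := by
  rw [← sum₂_linearized_curvature (d := fun i j U => metricClass hT hN (.inl i) (.inl j) U 0)
    (fun i j U => metricClass_symm _ _ _ _)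
    (fun i U hU => sum₁_metricClass_tangential hT_det i hU) α β hcard]
  refine sum₂_congr fun a b V hV => ?_
  have hV' : V.map Sum.inl = (V.map Sum.inl + (0 : Multiset (Fin l)).map Sum.inr) := by simp
  rw [hlin _ _ (by rw [← hV] at hn; simp at hn ⊢; omega), hV']
  simp only [fun A : AdmissibleMetric hT hN => jet_linCurvature A.2.smooth, inl_cons,
    jet_eq_metricJet]
  exact toQuotient_half _ _ _ _

theorem sum₂_curvatureClass_normal (α' β' : Fin l) (T : Multiset (Fin k)) {U : Multiset (Fin l)}
    (hcard : 2 ≤ Multiset.card U) (hn : Multiset.card T + Multiset.card U ≤ n + 1) :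
    sum₂ (fun a b V => curvatureClass hT hN ![.inr α', .inr a, .inr b, .inr β']
      (T.map Sum.inl + V.map Sum.inr)) U =
      ((1 / 2 : ℝ) * Multiset.card U * (Multiset.card U + 1)) •
        metricClass hT hN (.inr α') (.inr β') T U := by
  rw [← sum₂_linearized_curvature (d := fun i j U => metricClass hT hN (.inr i) (.inr j) T U)
    (fun i j U => metricClass_symm _ _ _ _)
    (fun i U hU => sum₁_metricClass_inr hT_det hN_det i (.inr hU)) α' β' hcard]
  refine sum₂_congr fun a b V hV => ?_
  rw [hlin _ _ (by rw [← hV] at hn; simp at hn ⊢; omega)]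
  simp only [fun A : AdmissibleMetric hT hN => jet_linCurvature A.2.smooth, inr_cons,
    jet_eq_metricJet]
  exact toQuotient_half _ _ _ _

/-- Three of the four linearized terms have a normal metric index contracted with a normal
derivative and vanish by the Gauss relations. Only `∂_a ∂_b g_{αβ}` remains, once for each ordered
pair. -/
theorem sum₂_curvatureClass_mixed (α β : Fin k) (T : Multiset (Fin k)) {U : Multiset (Fin l)}
    (hn : Multiset.card T + Multiset.card U ≤ n + 1) :
    sum₂ (fun a b V => curvatureClass hT hN ![.inl α, .inr a, .inr b, .inl β]
      (T.map Sum.inl + V.map Sum.inr)) U =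
      ((1 / 2 : ℝ) * Multiset.card U * (Multiset.card U - 1)) •
        metricClass hT hN (.inl α) (.inl β) T U := by
  have h1 : sum₂ (fun a b V => curvatureClass hT hN ![.inl α, .inr a, .inr b, .inl β]
      (T.map Sum.inl + V.map Sum.inr)) U = sum₂ (fun a b V => (1 / 2 : ℝ) •
        (metricClass hT hN (.inl β) (.inl α) T (a ::ₘ b ::ₘ V)
          - metricClass hT hN (.inl β) (.inr a) (α ::ₘ T) (b ::ₘ V)
          - metricClass hT hN (.inl α) (.inr b) (β ::ₘ T) (a ::ₘ V)
          + metricClass hT hN (.inr a) (.inr b) (α ::ₘ β ::ₘ T) V)) U := by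
    refine sum₂_congr fun a b V hV => ?_
    rw [hlin _ _ (by rw [← hV] at hn; simp at hn ⊢; omega), metricClass_symm (.inl α) (.inr b),
      metricClass_symm (.inr a) (.inr b)]
    simp only [fun A : AdmissibleMetric hT hN => jet_linCurvature A.2.smooth, inl_cons, inr_cons,
      jet_eq_metricJet]
    exact toQuotient_half _ _ _ _
  rw [h1, sum₂_smul, sum₂_add, sum₂_sub, sum₂_sub,
    sum₂_left (fun a V => metricClass hT hN (.inl β) (.inl α) T (a ::ₘ V)),
    sum₂_left (fun a V => metricClass hT hN (.inl β) (.inr a) (α ::ₘ T) V),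
    sum₂_right (fun b V => metricClass hT hN (.inl α) (.inr b) (β ::ₘ T) V),
    sum₁_const_cons (fun V => metricClass hT hN (.inl β) (.inl α) T V),
    sum₁_metricClass_inl hT_det hN_det, sum₁_metricClass_inl hT_det hN_det, sum₂,
    sum₁_eq_zero fun a V _ => sum₁_metricClass_inr hT_det hN_det a (.inl Multiset.cons_ne_zero),
    metricClass_symm (.inl β) (.inl α)]
  module

theorem sum₂_curvatureClass_mixed_normal (α : Fin k) (β' : Fin l) (T : Multiset (Fin k))
    {U : Multiset (Fin l)} (hn : Multiset.card T + Multiset.card U ≤ n + 1) :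
    sum₂ (fun a b V => curvatureClass hT hN ![.inl α, .inr a, .inr b, .inr β']
      (T.map Sum.inl + V.map Sum.inr)) U =
      ((1 / 2 : ℝ) * (Multiset.card U - 1) * (Multiset.card U + 1)) •
        metricClass hT hN (.inl α) (.inr β') T U := by
  have h1 : sum₂ (fun a b V => curvatureClass hT hN ![.inl α, .inr a, .inr b, .inr β']
      (T.map Sum.inl + V.map Sum.inr)) U = sum₂ (fun a b V => (1 / 2 : ℝ) •
        (metricClass hT hN (.inl α) (.inr β') T (a ::ₘ b ::ₘ V)
          - metricClass hT hN (.inr β') (.inr a) (α ::ₘ T) (b ::ₘ V)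
          - metricClass hT hN (.inl α) (.inr b) T (β' ::ₘ a ::ₘ V)
          + metricClass hT hN (.inr a) (.inr b) (α ::ₘ T) (β' ::ₘ V))) U := by
    refine sum₂_congr fun a b V hV => ?_
    rw [hlin _ _ (by rw [← hV] at hn; simp at hn ⊢; omega), metricClass_symm (.inl α) (.inr b),
      metricClass_symm (.inl α) (.inr β'),
      metricClass_symm (.inr a) (.inr b), Multiset.cons_swap β' a]
    simp only [fun A : AdmissibleMetric hT hN => jet_linCurvature A.2.smooth, inl_cons, inr_cons,
      jet_eq_metricJet]
    exact toQuotient_half _ _ _ _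
  -- The index `β'` is a derivative index outside the summation; the Gauss relation for `β' ::ₘ U`
  -- moves it into the metric component. With `h3` the total is `½ (n(n-1) + (n-1))`, where `n =
  -- card U`.
  have h2 : sum₁ (fun b V => metricClass hT hN (.inl α) (.inr b) T (β' ::ₘ V)) U =
      -metricClass hT hN (.inl α) (.inr β') T U := by
    have := sum₁_metricClass_inl hT_det hN_det α T (β' ::ₘ U)
    rw [sum₁_cons] at this
    exact eq_neg_of_add_eq_zero_right this
  have h3 : sum₂ (fun a b V => metricClass hT hN (.inr a) (.inr b) (α ::ₘ T) (β' ::ₘ V)) U = 0 := by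
    rw [← neg_eq_zero, ← sum₁_metricClass_inr hT_det hN_det β' (T := α ::ₘ T) (U := U)
      (.inl Multiset.cons_ne_zero), sum₂, ← sum₁_neg]
    -- The Gauss relation is used twice: the inner sum becomes `-g_{aβ'}`, whose outer sum vanishes.
    refine sum₁_congr fun a V _ => ?_
    have := sum₁_metricClass_inr hT_det hN_det a (T := α ::ₘ T) (U := β' ::ₘ V)
      (.inl Multiset.cons_ne_zero)
    rw [sum₁_cons] at this
    rw [metricClass_symm (.inr β'), neg_eq_iff_eq_neg]
    exact eq_neg_of_add_eq_zero_right this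
  rw [h1, sum₂_smul, sum₂_add, sum₂_sub, sum₂_sub,
    sum₂_left (fun a V => metricClass hT hN (.inl α) (.inr β') T (a ::ₘ V)),
    sum₂_left (fun a V => metricClass hT hN (.inr β') (.inr a) (α ::ₘ T) V),
    sum₂_right (fun b V => metricClass hT hN (.inl α) (.inr b) T (β' ::ₘ V)),
    sum₁_const_cons (fun V => metricClass hT hN (.inl α) (.inr β') T V),
    sum₁_metricClass_inr hT_det hN_det _ (.inl Multiset.cons_ne_zero), h2, h3]
  module

/-- Antisymmetry in `β'`, `γ'` merges the four linearized terms into two. By the parallelism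
relation the first sums to `-g_{αβ',Tγ'}`, and the second contributes `-card T` copies of the same
derivative. -/
theorem sum₁_curvatureClass_mixed (α : Fin k) (β' γ' : Fin l) {T : Multiset (Fin k)}
    (hn : Multiset.card T ≤ n) :
    sum₁ (fun a V => curvatureClass hT hN ![.inr β', .inr γ', .inl α, .inl a] (V.map Sum.inl)) T =
      -((Multiset.card T + 1 : ℝ)) • metricClass hT hN (.inl α) (.inr β') T {γ'} := by
  have h1 : sum₁ (fun a V => curvatureClass hT hN ![.inr β', .inr γ', .inl α, .inl a]
      (V.map Sum.inl)) T = sum₁ (fun a V =>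
        metricClass hT hN (.inl a) (.inr β') (α ::ₘ V) {γ'}
          - metricClass hT hN (.inl α) (.inr β') (a ::ₘ V) {γ'}) T := by
    refine sum₁_congr fun a V hV => ?_
    have hV' : V.map Sum.inl = (V.map Sum.inl + (0 : Multiset (Fin l)).map Sum.inr) := by simp
    rw [hlin _ _ (by rw [← hV] at hn; simp at hn ⊢; omega), hV']
    simp only [fun A : AdmissibleMetric hT hN => jet_linCurvature A.2.smooth, inl_cons, inr_cons,
      jet_eq_metricJet, Multiset.cons_zero]
    refine (toQuotient_half _ _ _ _).trans ?_
    change (1 / 2 : ℝ) • (metricClass hT hN (.inl a) (.inr β') (α ::ₘ V) {γ'}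
      - metricClass hT hN (.inl a) (.inr γ') (α ::ₘ V) {β'}
      - metricClass hT hN (.inl α) (.inr β') (a ::ₘ V) {γ'}
      + metricClass hT hN (.inl α) (.inr γ') (a ::ₘ V) {β'}) = _
    rw [metricClass_inl_inr_antisymm hT_det hN_det a β' γ',
      metricClass_inl_inr_antisymm hT_det hN_det α β' γ']
    module
  have h2 : sum₁ (fun a V => metricClass hT hN (.inl a) (.inr β') (α ::ₘ V) {γ'}) T =
      -metricClass hT hN (.inl α) (.inr β') T {γ'} := by
    have := sum₁_metricClass_inl_inr hT_det hN_det β' γ' (α ::ₘ T)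
    rw [sum₁_cons] at this
    exact eq_neg_of_add_eq_zero_right this
  rw [h1, sum₁_sub, h2, sum₁_const_cons (fun V => metricClass hT hN (.inl α) (.inr β') V {γ'})]
  module

/-- The solving step of the induction: each metric derivative of order at most `n + 1` either
vanishes in the quotient, is a multiple of a derivative of `L`, or has a nonzero multiple equal to a
sum of curvature derivatives of order less than `n`. -/
theorem metricClass_mem
    (hmem : ∀ a (c : Multiset (Fin k ⊕ Fin l)), Multiset.card c + 1 ≤ n →
      curvatureClass hT hN a c ∈ positiveClasses hT hN)
    (hsff : ∀ a ν c, Multiset.card c ≤ n → sffClass hT hN a ν c ∈ positiveClasses hT hN)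
    (i j : Fin k ⊕ Fin l) (T : Multiset (Fin k)) (U : Multiset (Fin l))
    (h1 : 1 ≤ Multiset.card T + Multiset.card U) (hn : Multiset.card T + Multiset.card U ≤ n + 1) :
    metricClass hT hN i j T U ∈ positiveClasses hT hN := by
  have hU : U = 0 ∨ (∃ γ', U = {γ'}) ∨ 2 ≤ Multiset.card U := by
    rcases Nat.lt_or_ge (Multiset.card U) 2 with h | h
    · interval_cases hc : Multiset.card U
      · exact .inl (Multiset.card_eq_zero.1 hc)
      · exact .inr (.inl (Multiset.card_eq_one.1 hc))
    · exact .inr (.inr h)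
  have hmixed : ∀ (α : Fin k) (β' : Fin l),
      metricClass hT hN (.inl α) (.inr β') T U ∈ positiveClasses hT hN := fun α β' => by
    rcases hU with rfl | ⟨γ', rfl⟩ | hU
    · rw [metricClass_inl_inr_zero]
      exact Submodule.zero_mem _
    · refine (Submodule.smul_mem_iff _ ?_).1 (sum₁_curvatureClass_mixed hT_det hN_det hlin α β' γ'
        (T := T) (by simpa using hn) ▸ sum₁_mem _ fun a V hV => hmem _ _ ?_)
      · exact neg_ne_zero.2 (by positivity)
      · simp [← hV] at hn ⊢
        omega
    · have h2 : (2 : ℝ) ≤ Multiset.card U := by exact_mod_cast hU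
      refine (Submodule.smul_mem_iff _ ?_).1 (sum₂_curvatureClass_mixed_normal hT_det hN_det hlin
        α β' T hn ▸ sum₂_mem _ fun a b V hV => hmem _ _ ?_)
      · exact mul_ne_zero (mul_ne_zero (by norm_num) (by linarith)) (by linarith)
      · simp [← hV] at hn ⊢
        omega
  rcases i with α | α' <;> rcases j with β | β'
  · rcases hU with rfl | ⟨γ', rfl⟩ | hU
    · rcases Nat.lt_or_ge (Multiset.card T) 2 with h | h
      · obtain ⟨γ, rfl⟩ := Multiset.card_eq_one.1
          (show Multiset.card T = 1 by simp at h1; omega)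
        rw [metricClass_inl_inl_singleton hT_det]
        exact Submodule.zero_mem _
      · have h2 : (2 : ℝ) ≤ Multiset.card T := by exact_mod_cast h
        refine (Submodule.smul_mem_iff _ ?_).1 (sum₂_curvatureClass_tangential hT_det hlin
          α β h (by simpa using hn) ▸ sum₂_mem _ fun a b V hV => hmem _ _ ?_)
        · exact mul_ne_zero (mul_ne_zero (by norm_num) (by linarith)) (by linarith)
        · simp [← hV] at hn ⊢
          omega
    · have := hsff ![α, β] γ' T (by simpa using hn)
      rw [sffClass_eq hT_det hN_det] at this
      exact (Submodule.smul_mem_iff _ (by norm_num)).1 this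
    · have h2 : (2 : ℝ) ≤ Multiset.card U := by exact_mod_cast hU
      refine (Submodule.smul_mem_iff _ ?_).1 (sum₂_curvatureClass_mixed hT_det hN_det hlin
        α β T hn ▸ sum₂_mem _ fun a b V hV => hmem _ _ ?_)
      · exact mul_ne_zero (mul_ne_zero (by norm_num) (by linarith)) (by linarith)
      · simp [← hV] at hn ⊢
        omega
  · exact hmixed α β'
  · rw [metricClass_symm]
    exact hmixed β α'
  · rcases hU with rfl | ⟨γ', rfl⟩ | hU
    · rw [metricClass_inr_inr_zero hT_det hN_det _ _ (by rintro rfl; simp at h1)]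
      exact Submodule.zero_mem _
    · rw [metricClass_inr_inr_singleton hT_det hN_det]
      exact Submodule.zero_mem _
    · have h2 : (2 : ℝ) ≤ Multiset.card U := by exact_mod_cast hU
      refine (Submodule.smul_mem_iff _ ?_).1 (sum₂_curvatureClass_normal hT_det hN_det hlin
        α' β' T hU hn ▸ sum₂_mem _ fun a b V hV => hmem _ _ ?_)
      · exact mul_ne_zero (mul_ne_zero (by norm_num) (by linarith)) (by linarith)
      · simp [← hV] at hn ⊢
        omega

end

end Formulas

/-! ### Induction on the order, and symmetrized covariant derivatives in the quotient -/

section AllOrders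

open Filter

variable {k l : ℕ} {hT : Matrix (Fin k) (Fin k) ℝ} {hN : Matrix (Fin l) (Fin l) ℝ}

theorem nablaCurvature_mem_polyOrder (m : ℕ) (a : Fin 4 → Fin k ⊕ Fin l)
    (c : Fin m → Fin k ⊕ Fin l) :
    (fun A : AdmissibleMetric hT hN => nablaCurvature A.1 m a c 0) ∈
      polyOrder (jetVals hT hN) 1 := val_mem_polyOrder (val := jetVals hT hN) (JetVar.curv m a c)

theorem nablaSecondFundamentalForm_mem_polyOrder (m : ℕ) (a : Fin 2 → Fin k) (ν : Fin l)
    (c : Fin m → Fin k) :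
    (fun A : AdmissibleMetric hT hN => nablaSecondFundamentalForm A.1 m a ν c 0) ∈
      polyOrder (jetVals hT hN) 1 := val_mem_polyOrder (val := jetVals hT hN) (JetVar.sff m a ν c)

variable (hT_det : hT.det ≠ 0) (hN_det : hN.det ≠ 0)
include hT_det hN_det

theorem curvatureClass_eq_of_mem {s : ℕ}
    (hs : ∀ i j m, (fun A : AdmissibleMetric hT hN => pd (fun y => A.1 y i j) m) ∈
      jetOrder (jetVals hT hN) 1 s) (a : Fin 4 → Fin k ⊕ Fin l) (c : Multiset (Fin k ⊕ Fin l))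
    (hc : Multiset.card c ≤ s) :
    curvatureClass hT hN a c = toQuotient hT hN fun A => jet (linCurvature A.1 a) c := by
  have h := curvature_sub_linCurvature_mem (G := fun A : AdmissibleMetric hT hN => A.1)
    (fun A => A.2.smooth) (fun A => A.2.frame) hs (det_frame_ne_zero hT_det hN_det) a
  refine toQuotient_eq_iff.2 ?_
  convert jet_mem h hc using 1
  ext A
  have h1 : SmoothAt (curvature A.1 a) := smoothAt_nablaCurvature
    (G := fun A : AdmissibleMetric hT hN => A.1) (fun A => A.2.smooth) (fun A => A.2.frame) hs
    (det_frame_ne_zero hT_det hN_det) 0 a Fin.elim0 A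
  exact (jet_sub h1 (smoothAt_linCurvature A.2.smooth a) c).symm

theorem pd_metric_mem_jetOrder (s : ℕ) (i j m : Fin k ⊕ Fin l) :
    (fun A : AdmissibleMetric hT hN => pd (fun y => A.1 y i j) m) ∈
      jetOrder (jetVals hT hN) 1 s := by
  have step : ∀ n : ℕ,
      (∀ a (c : Multiset (Fin k ⊕ Fin l)), Multiset.card c + 1 ≤ n →
        curvatureClass hT hN a c = toQuotient hT hN fun A => jet (linCurvature A.1 a) c) →
      (∀ a (c : Multiset (Fin k ⊕ Fin l)), Multiset.card c + 1 ≤ n →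
        curvatureClass hT hN a c ∈ positiveClasses hT hN) →
      (∀ a ν c, Multiset.card c ≤ n → sffClass hT hN a ν c ∈ positiveClasses hT hN) →
      ∀ i j m, (fun A : AdmissibleMetric hT hN => pd (fun y => A.1 y i j) m) ∈
        jetOrder (jetVals hT hN) 1 n := fun n hlin hmem hsff i j m => by
    refine ⟨fun A => (A.2.smooth i j).pd m, fun c hc => ?_⟩
    simp only [fun A : AdmissibleMetric hT hN => (jet_cons (A.2.smooth i j) m c).symm]
    obtain ⟨T, U, h⟩ := exists_eq_map_add_map (m ::ₘ c)
    have hcard := congrArg Multiset.card h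
    simp only [Multiset.card_cons, Multiset.card_add, Multiset.card_map] at hcard
    rw [h]
    exact toQuotient_mem_iff.1
      (metricClass_mem hT_det hN_det hlin hmem hsff i j T U (by omega) (by omega))
  induction s generalizing i j m with
  | zero =>
    -- First derivatives of the metric involve no curvature, so the two curvature hypotheses are
    -- vacuous; `L` at the origin is itself a jet variable.
    refine step 0 (fun a c h => by omega) (fun a c h => by omega) (fun a ν c h => ?_) i j m
    obtain rfl : c = 0 := Multiset.card_eq_zero.1 (Nat.le_zero.1 h)
    refine toQuotient_mem_iff.2 ?_
    simp only [jet_zero]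
    exact nablaSecondFundamentalForm_mem_polyOrder 0 a ν Fin.elim0
  | succ s ih =>
    refine step (s + 1)
      (fun a c h => curvatureClass_eq_of_mem hT_det hN_det ih a c (by omega))
      (fun a c h => toQuotient_mem_iff.2 ?_) (fun a ν c h => toQuotient_mem_iff.2 ?_) i j m
    · exact jet_mem (curvature_mem_jetOrder (G := fun A : AdmissibleMetric hT hN => A.1)
        (fun A => A.2.smooth) (fun A => A.2.frame) ih (det_frame_ne_zero hT_det hN_det)
        nablaCurvature_mem_polyOrder a) (by omega)
    · exact jet_mem (secondFundamentalForm_mem_jetOrder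
        (G := fun A : AdmissibleMetric hT hN => A.1) (fun A => A.2) hT_det hN_det ih
        nablaSecondFundamentalForm_mem_polyOrder a ν) h

theorem curvatureClass_eq (a : Fin 4 → Fin k ⊕ Fin l) (c : Multiset (Fin k ⊕ Fin l)) :
    curvatureClass hT hN a c = toQuotient hT hN fun A => jet (linCurvature A.1 a) c :=
  curvatureClass_eq_of_mem hT_det hN_det (pd_metric_mem_jetOrder hT_det hN_det _) a c le_rfl

theorem toQuotient_nablaCurvature (m : ℕ) (a : Fin 4 → Fin k ⊕ Fin l)
    (c : Fin m → Fin k ⊕ Fin l) :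
    (toQuotient hT hN fun A => nablaCurvature A.1 m a c 0) = curvatureClass hT hN a (mset c) :=
  toQuotient_eq_iff.2 (nablaCurvature_sub_jet_mem (G := fun A : AdmissibleMetric hT hN => A.1)
    (fun A => A.2.smooth) (fun A => A.2.frame) (pd_metric_mem_jetOrder hT_det hN_det m)
    (det_frame_ne_zero hT_det hN_det) nablaCurvature_mem_polyOrder m (by omega) a c)

theorem toQuotient_nablaSecondFundamentalForm (m : ℕ) (a : Fin 2 → Fin k) (ν : Fin l)
    (c : Fin m → Fin k) :
    (toQuotient hT hN fun A => nablaSecondFundamentalForm A.1 m a ν c 0) =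
      sffClass hT hN a ν (mset c) :=
  toQuotient_eq_iff.2 (nablaSecondFundamentalForm_sub_jet_mem
    (G := fun A : AdmissibleMetric hT hN => A.1) (fun A => A.2) hT_det hN_det
    (pd_metric_mem_jetOrder hT_det hN_det m) nablaSecondFundamentalForm_mem_polyOrder m
    (by omega) a ν c)

theorem toQuotient_symCurvature {ν : Type} [DecidableEq ν] (e : ν → Fin k ⊕ Fin l)
    (i j : Fin k ⊕ Fin l) {N r : ℕ} (c : Fin (N + 2) → ν) (d : Fin r → Fin k ⊕ Fin l) :
    (toQuotient hT hN fun A => symCurvature A.1 i j (e ∘ c) d) =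
      (1 / (((N : ℝ) + 2) * (N + 1))) • sum₂ (fun a b V =>
        curvatureClass hT hN ![i, e a, e b, j] (V.map e + mset d)) (mset c) := by
  have h1 : (fun A : AdmissibleMetric hT hN => symCurvature A.1 i j (e ∘ c) d) =
      (1 / ((N + 2).factorial : ℝ)) • ∑ σ : Equiv.Perm (Fin (N + 2)),
        fun A : AdmissibleMetric hT hN =>
          nablaCurvature A.1 (N + r) ![i, e (c (σ 0)), e (c (σ 1)), j]
            (Fin.append (fun s : Fin N => e (c (σ s.succ.succ))) d) 0 := by
    ext A
    simp [symCurvature, Finset.sum_apply]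
  rw [h1, map_smul, map_sum]
  simp only [toQuotient_nablaCurvature hT_det hN_det, mset_append]
  have h2 : ∀ σ : Equiv.Perm (Fin (N + 2)), mset (fun s : Fin N => e (c (σ s.succ.succ))) =
      (mset fun s : Fin N => c (σ s.succ.succ)).map e := fun σ => mset_comp _ e
  simp only [h2]
  -- The weight becomes `N! / (N+2)! = 1 / ((N+2)(N+1))`, one over the number of ordered pairs of
  -- positions.
  rw [sum_perm_eq_sum₂ (fun a b V => curvatureClass hT hN ![i, e a, e b, j] (V.map e + mset d)),
    ← Nat.cast_smul_eq_nsmul ℝ, smul_smul]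
  congr 1
  have : (N.factorial : ℝ) ≠ 0 := by exact_mod_cast N.factorial_ne_zero
  rw [Nat.factorial_succ, Nat.factorial_succ]
  push_cast
  field_simp
  ring

theorem toQuotient_symCurvature' {ν : Type} [DecidableEq ν] (e : ν → Fin k ⊕ Fin l)
    (i j p : Fin k ⊕ Fin l) {M : ℕ} (c : Fin (M + 1) → ν) :
    (toQuotient hT hN fun A => symCurvature' A.1 i j p (e ∘ c)) =
      (1 / ((M : ℝ) + 1)) • sum₁ (fun a V =>
        curvatureClass hT hN ![i, j, p, e a] (V.map e)) (mset c) := by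
  have h1 : (fun A : AdmissibleMetric hT hN => symCurvature' A.1 i j p (e ∘ c)) =
      (1 / ((M + 1).factorial : ℝ)) • ∑ σ : Equiv.Perm (Fin (M + 1)),
        fun A : AdmissibleMetric hT hN =>
          nablaCurvature A.1 M ![i, j, p, e (c (σ 0))] (fun s : Fin M => e (c (σ s.succ))) 0 := by
    ext A
    simp [symCurvature', Finset.sum_apply]
  rw [h1, map_smul, map_sum]
  simp only [toQuotient_nablaCurvature hT_det hN_det]
  have h2 : ∀ σ : Equiv.Perm (Fin (M + 1)), mset (fun s : Fin M => e (c (σ s.succ))) =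
      (mset fun s : Fin M => c (σ s.succ)).map e := fun σ => mset_comp _ e
  simp only [h2]
  rw [sum_perm_eq_sum₁ (fun a V => curvatureClass hT hN ![i, j, p, e a] (V.map e)),
    ← Nat.cast_smul_eq_nsmul ℝ, smul_smul]
  congr 1
  have : (M.factorial : ℝ) ≠ 0 := by exact_mod_cast M.factorial_ne_zero
  rw [Nat.factorial_succ]
  push_cast
  field_simp

end AllOrders

/-! ### The leading terms -/

section LeadingTerm

variable {k l : ℕ} (hT : Matrix (Fin k) (Fin k) ℝ) (hN : Matrix (Fin l) (Fin l) ℝ)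

/-- The part of a partial derivative of a metric component that is affine in the jet variables.
The component with first index normal and second index tangential is left out. -/
noncomputable def leadingTerm
    (G : (Fin k ⊕ Fin l → ℝ) → Matrix (Fin k ⊕ Fin l) (Fin k ⊕ Fin l) ℝ) :
    Fin k ⊕ Fin l → Fin k ⊕ Fin l → (Σ m, Fin m → Fin k) → (Σ n, Fin n → Fin l) → ℝ
  | .inl α, .inl β, ⟨0, _⟩, ⟨0, _⟩ => hT α β
  | .inl _, .inl _, ⟨1, _⟩, ⟨0, _⟩ => 0
  | .inl α, .inl β, ⟨m + 2, γ⟩, ⟨0, _⟩ =>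
      2 * ((((m + 2 : ℕ) : ℝ) - 1) / (((m + 2 : ℕ) : ℝ) + 1)) *
        symCurvature G (.inl α) (.inl β) (Sum.inl ∘ γ) ![]
  | .inl α, .inl β, ⟨m, γ⟩, ⟨1, γ'⟩ => -2 * nablaSecondFundamentalForm G m ![α, β] (γ' 0) γ 0
  | .inl α, .inl β, ⟨_, γ⟩, ⟨_ + 2, γ'⟩ =>
      2 * symCurvature G (.inl α) (.inl β) (Sum.inr ∘ γ') (Sum.inl ∘ γ)
  | .inl _, .inr _, _, ⟨0, _⟩ => 0
  | .inl _, .inr _, ⟨0, _⟩, ⟨1, _⟩ => 0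
  | .inl α, .inr β', ⟨m + 1, γ⟩, ⟨1, γ'⟩ =>
      -(((m + 1 : ℕ) : ℝ) / (((m + 1 : ℕ) : ℝ) + 1)) *
        symCurvature' G (.inr β') (.inr (γ' 0)) (.inl α) (Sum.inl ∘ γ)
  | .inl α, .inr β', ⟨_, γ⟩, ⟨n + 2, γ'⟩ =>
      2 * (((n + 2 : ℕ) : ℝ) / (((n + 2 : ℕ) : ℝ) + 1)) *
        symCurvature G (.inl α) (.inr β') (Sum.inr ∘ γ') (Sum.inl ∘ γ)
  | .inr α', .inr β', ⟨0, _⟩, ⟨0, _⟩ => hN α' β'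
  | .inr _, .inr _, ⟨_ + 1, _⟩, ⟨0, _⟩ => 0
  | .inr _, .inr _, _, ⟨1, _⟩ => 0
  | .inr α', .inr β', ⟨_, γ⟩, ⟨n + 2, γ'⟩ =>
      2 * ((((n + 2 : ℕ) : ℝ) - 1) / (((n + 2 : ℕ) : ℝ) + 1)) *
        symCurvature G (.inr α') (.inr β') (Sum.inr ∘ γ') (Sum.inl ∘ γ)
  | .inr _, .inl _, _, _ => 0

variable {hT hN} (hT_det : hT.det ≠ 0) (hN_det : hN.det ≠ 0)
include hT_det hN_det

/-- Each stated coefficient is the reciprocal of the symmetrization weight times the factor from the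
corresponding contracted curvature identity. For instance, with `M` tangential derivatives, `½
M(M+1) / (M(M-1))` inverts to `2(M-1)/(M+1)`. -/
theorem metricClass_eq_leadingTerm (i j : Fin k ⊕ Fin l) (hij : i.isLeft ∨ j.isRight) {m n : ℕ}
    (γ : Fin m → Fin k) (γ' : Fin n → Fin l) :
    metricClass hT hN i j (mset γ) (mset γ') =
      toQuotient hT hN fun A => leadingTerm hT hN A.1 i j ⟨m, γ⟩ ⟨n, γ'⟩ := by
  have hlin {n : ℕ} : ∀ a (c : Multiset (Fin k ⊕ Fin l)), Multiset.card c + 1 ≤ n →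
    curvatureClass hT hN a c = toQuotient hT hN fun A => jet (linCurvature A.1 a) c :=
    fun a c _ => curvatureClass_eq hT_det hN_det a c
  have hsmul : ∀ (r : ℝ) (f : AdmissibleMetric hT hN → ℝ),
      (toQuotient hT hN fun A => r * f A) = r • toQuotient hT hN f := fun r f => map_smul _ r f
  have hzero : (toQuotient hT hN fun _ => (0 : ℝ)) = 0 := map_zero _
  have hmset0 : ∀ {α : Type} (c : Fin 0 → α), mset c = 0 := fun c => by simp [mset]
  have hmset1 : ∀ {α : Type} (c : Fin 1 → α), mset c = {c 0} := fun c => by simp [mset]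
  have hinl : ∀ {m n : ℕ} (γ : Fin m → Fin k) (i j : Fin k ⊕ Fin l) (γ' : Fin (n + 2) → Fin l),
      (toQuotient hT hN fun A => symCurvature A.1 i j (Sum.inr ∘ γ') (Sum.inl ∘ γ)) =
      (1 / (((n : ℝ) + 2) * (n + 1))) • sum₂ (fun a b V =>
        curvatureClass hT hN ![i, .inr a, .inr b, j] ((mset γ).map Sum.inl + V.map Sum.inr))
          (mset γ') := fun γ i j γ' => by
    rw [toQuotient_symCurvature hT_det hN_det]
    simp only [mset_comp, add_comm]
  rcases i with α | α' <;> rcases j with β | β'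
  · match n, γ' with
    | 0, γ' =>
      match m, γ with
      | 0, γ =>
        simp only [leadingTerm, hmset0, metricClass]
        congr 1
        ext A
        simp [metricJet, jet_zero, A.2.frame]
      | 1, γ =>
        simp only [leadingTerm, hmset0, hmset1, hzero]
        exact metricClass_inl_inl_singleton hT_det α β (γ 0)
      | m + 2, γ =>
        simp only [leadingTerm, hmset0, hsmul]
        rw [toQuotient_symCurvature hT_det hN_det]
        simp only [hmset0, add_zero]
        rw [sum₂_curvatureClass_tangential hT_det hlin (n := m + 1) α β
          (by rw [card_mset]; omega) (by rw [card_mset]), card_mset, smul_smul, smul_smul]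
        convert (one_smul ℝ _).symm using 2
        push_cast
        have : (m : ℝ) + 2 - 1 = m + 1 := by ring
        rw [this]
        field_simp
    | 1, γ' =>
      simp only [leadingTerm, hmset1, hsmul]
      rw [toQuotient_nablaSecondFundamentalForm hT_det hN_det, sffClass_eq hT_det hN_det, smul_smul]
      simp
    | n + 2, γ' =>
      simp only [leadingTerm, hsmul, hinl]
      rw [sum₂_curvatureClass_mixed hT_det hN_det hlin (n := m + n + 1) α β (mset γ)
        (by rw [card_mset, card_mset]; omega), card_mset, smul_smul, smul_smul]
      convert (one_smul ℝ _).symm using 2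
      push_cast
      have : (n : ℝ) + 2 - 1 = n + 1 := by ring
      rw [this]
      field_simp
  · match n, γ' with
    | 0, γ' =>
      simp only [leadingTerm, hmset0, hzero]
      exact metricClass_inl_inr_zero _ _ _
    | 1, γ' =>
      match m, γ with
      | 0, γ =>
        have h := sum₁_metricClass_inl_inr hT_det hN_det β' (γ' 0) (α ::ₘ 0)
        rw [sum₁_cons, sum₁_empty, add_zero] at h
        simpa only [leadingTerm, hmset0, hmset1, hzero] using h
      | m + 1, γ =>
        simp only [leadingTerm, hmset1, hsmul]
        rw [toQuotient_symCurvature' hT_det hN_det,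
          sum₁_curvatureClass_mixed hT_det hN_det hlin (n := m + 1) α β' (γ' 0)
          (by rw [card_mset]), card_mset, smul_smul, smul_smul]
        convert (one_smul ℝ _).symm using 2
        push_cast
        field_simp
    | n + 2, γ' =>
      simp only [leadingTerm, hsmul, hinl]
      rw [sum₂_curvatureClass_mixed_normal hT_det hN_det hlin (n := m + n + 1) α β' (mset γ)
        (by rw [card_mset, card_mset]; omega), card_mset, smul_smul, smul_smul]
      convert (one_smul ℝ _).symm using 2
      push_cast
      have : (n : ℝ) + 2 - 1 = n + 1 := by ring
      rw [this]
      field_simp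
  · simp at hij
  · match n, γ' with
    | 0, γ' =>
      match m, γ with
      | 0, γ =>
        simp only [leadingTerm, hmset0, metricClass]
        congr 1
        ext A
        simp [metricJet, jet_zero, A.2.frame]
      | m + 1, γ =>
        simp only [leadingTerm, hmset0, hzero]
        exact metricClass_inr_inr_zero hT_det hN_det _ _ (by simp [mset_cons])
    | 1, γ' =>
      simp only [leadingTerm, hmset1, hzero]
      exact metricClass_inr_inr_singleton hT_det hN_det _ _ _ _
    | n + 2, γ' =>
      simp only [leadingTerm, hsmul, hinl]
      rw [sum₂_curvatureClass_normal hT_det hN_det hlin (n := m + n + 1) α' β' (mset γ)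
        (by rw [card_mset]; omega) (by rw [card_mset, card_mset]; omega), card_mset, smul_smul,
        smul_smul]
      convert (one_smul ℝ _).symm using 2
      push_cast
      have : (n : ℝ) + 2 - 1 = n + 1 := by ring
      rw [this]
      field_simp

end LeadingTerm

/-! ### Smoothness of the metric components -/

section Charts

open Filter Bundle

variable {k l : ℕ} {M : Type*} [TopologicalSpace M]
  [ChartedSpace (EuclideanSpace ℝ (Fin (k + l))) M] [IsManifold (𝓡 (k + l)) ∞ M]

/-- The coordinate field is the tangent map of `z.symm` applied to a constant section; on the open
target the derivative within the set is the full derivative. -/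
theorem contMDiffAt_coordVector {z : OpenPartialHomeomorph M (Fin k ⊕ Fin l → ℝ)}
    (hz : ContMDiffOn 𝓘(ℝ, Fin k ⊕ Fin l → ℝ) (𝓡 (k + l)) ∞ z.symm z.target) (i : Fin k ⊕ Fin l)
    {y : Fin k ⊕ Fin l → ℝ} (hy : y ∈ z.target) :
    ContMDiffAt 𝓘(ℝ, Fin k ⊕ Fin l → ℝ) (𝓡 (k + l)).tangent ∞
      (fun y => TotalSpace.mk' (EuclideanSpace ℝ (Fin (k + l))) (z.symm y) (coordVector z i y)) y := by
  have h1 := hz.contMDiffOn_tangentMapWithin (m := ∞) (by simp) z.open_target.uniqueMDiffOn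
  have h2 : ContMDiffAt 𝓘(ℝ, Fin k ⊕ Fin l → ℝ) 𝓘(ℝ, Fin k ⊕ Fin l → ℝ).tangent ∞
      (fun y => (⟨y, (Pi.single i 1 : Fin k ⊕ Fin l → ℝ)⟩ :
        TangentBundle 𝓘(ℝ, Fin k ⊕ Fin l → ℝ) (Fin k ⊕ Fin l → ℝ))) y :=
    contMDiffAt_vectorSpace_iff_contDiffAt.2 contDiffAt_const
  have h3 := (h1 ⟨y, (Pi.single i 1 : Fin k ⊕ Fin l → ℝ)⟩ hy).comp_of_eq
    (h2.contMDiffWithinAt (s := z.target)) (fun y hy => hy) rfl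
  refine (h3.contMDiffAt (z.open_target.mem_nhds hy)).congr_of_eventuallyEq ?_
  filter_upwards [z.open_target.mem_nhds hy] with w hw
  simp only [Function.comp, tangentMapWithin, coordVector,
    mfderivWithin_of_isOpen z.open_target hw]

theorem smoothAt_metricCoeff (g : PseudoRiemannianMetric (k + l) M)
    {z : OpenPartialHomeomorph M (Fin k ⊕ Fin l → ℝ)}
    (hz : ContMDiffOn 𝓘(ℝ, Fin k ⊕ Fin l → ℝ) (𝓡 (k + l)) ∞ z.symm z.target)
    (h0 : (0 : Fin k ⊕ Fin l → ℝ) ∈ z.target) (i j : Fin k ⊕ Fin l) :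
    SmoothAt fun y => metricCoeff g z y i j := by
  have h1 : ContMDiffAt 𝓘(ℝ, Fin k ⊕ Fin l → ℝ) ((𝓡 (k + l)).prod 𝓘(ℝ)) ∞
      (fun y => TotalSpace.mk' ℝ (E := Bundle.Trivial M ℝ) (z.symm y)
        (g.val (z.symm y) (coordVector z i y) (coordVector z j y))) 0 := by
    apply ContMDiffAt.clm_bundle_apply₂ (F₁ := EuclideanSpace ℝ (Fin (k + l)))
      (F₂ := EuclideanSpace ℝ (Fin (k + l)))
    · exact ContMDiffAt.comp 0 g.contMDiff.contMDiffAt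
        (hz.contMDiffAt (z.open_target.mem_nhds h0))
    · exact contMDiffAt_coordVector hz i h0
    · exact contMDiffAt_coordVector hz j h0
  simp only [contMDiffAt_totalSpace] at h1
  exact h1.2.contDiffAt

theorem IsSubmanifoldNormalCoords.admissible {g : PseudoRiemannianMetric (k + l) M} {S : Set M}
    {p : M} {hT : Matrix (Fin k) (Fin k) ℝ} {hN : Matrix (Fin l) (Fin l) ℝ}
    {z : OpenPartialHomeomorph M (Fin k ⊕ Fin l → ℝ)}
    (h : IsSubmanifoldNormalCoords g S p hT hN z) : Admissible hT hN (metricCoeff g z) where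
  smooth := smoothAt_metricCoeff g h.smooth_symm (h.map_base ▸ z.map_source h.mem_source)
  symm _ _ _ := g.symm _ _ _
  frame := h.frame
  radial_geodesic := h.radial_geodesic
  normal := h.normal
  normal_parallel := h.normal_parallel
  normal_geodesic := h.normal_geodesic

end Charts

/-! ### Tangential and normal indices of a list -/

section Indices

variable {k l : ℕ}

/-- The tangential indices of a tuple, in order. -/
def tangentialPart (K : Σ m : ℕ, Fin m → Fin k ⊕ Fin l) : Σ m : ℕ, Fin m → Fin k :=
  List.equivSigmaTuple ((List.ofFn K.2).filterMap Sum.getLeft?)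

/-- The normal indices of a tuple, in order. -/
def normalPart (K : Σ m : ℕ, Fin m → Fin k ⊕ Fin l) : Σ m : ℕ, Fin m → Fin l :=
  List.equivSigmaTuple ((List.ofFn K.2).filterMap Sum.getRight?)

theorem mset_equivSigmaTuple {α : Type} (s : List α) :
    mset (List.equivSigmaTuple s).2 = (s : Multiset α) :=
  congrArg _ (List.equivSigmaTuple.symm_apply_apply s)

theorem mset_eq_parts (K : Σ m : ℕ, Fin m → Fin k ⊕ Fin l) :
    mset K.2 = (mset (tangentialPart K).2).map Sum.inl + (mset (normalPart K).2).map Sum.inr := by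
  rw [tangentialPart, normalPart, mset_equivSigmaTuple, mset_equivSigmaTuple, mset]
  induction List.ofFn K.2 with
  | nil => rfl
  | cons i s ih =>
    rw [← Multiset.cons_coe, ih]
    rcases i with α | α
    · rw [inl_cons, List.filterMap_cons_some (f := Sum.getLeft?) (b := α) rfl,
        List.filterMap_cons_none (f := Sum.getRight?) rfl, ← Multiset.cons_coe]
    · rw [inr_cons, List.filterMap_cons_some (f := Sum.getRight?) (b := α) rfl,
        List.filterMap_cons_none (f := Sum.getLeft?) rfl, ← Multiset.cons_coe]

theorem tangentialPart_append {m n : ℕ} (γ : Fin m → Fin k) (γ' : Fin n → Fin l) :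
    tangentialPart ⟨m + n, Fin.append (Sum.inl ∘ γ) (Sum.inr ∘ γ')⟩ = ⟨m, γ⟩ := by
  rw [tangentialPart, ← Equiv.eq_symm_apply]
  change _ = List.ofFn γ
  simp only [List.ofFn_fin_append, ← List.map_ofFn, List.filterMap_append, List.filterMap_map]
  simp [Function.comp_def]

theorem normalPart_append {m n : ℕ} (γ : Fin m → Fin k) (γ' : Fin n → Fin l) :
    normalPart ⟨m + n, Fin.append (Sum.inl ∘ γ) (Sum.inr ∘ γ')⟩ = ⟨n, γ'⟩ := by
  rw [normalPart, ← Equiv.eq_symm_apply]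
  change _ = List.ofFn γ'
  simp only [List.ofFn_fin_append, ← List.map_ofFn, List.filterMap_append, List.filterMap_map]
  simp [Function.comp_def]

theorem tangentialPart_inl {m : ℕ} (γ : Fin m → Fin k) :
    tangentialPart (l := l) ⟨m, Sum.inl ∘ γ⟩ = ⟨m, γ⟩ := by
  rw [tangentialPart, ← Equiv.eq_symm_apply]
  change _ = List.ofFn γ
  simp only [← List.map_ofFn, List.filterMap_map]
  simp [Function.comp_def]

theorem normalPart_inl {m : ℕ} (γ : Fin m → Fin k) :
    normalPart (l := l) ⟨m, Sum.inl ∘ γ⟩ = ⟨0, ![]⟩ := by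
  rw [normalPart, ← Equiv.eq_symm_apply]
  change _ = List.ofFn ![]
  simp only [← List.map_ofFn, List.filterMap_map]
  simp [Function.comp_def]

/-- Every partial derivative of the metric is its leading term plus a universal polynomial without
terms of degree less than two. -/
theorem exists_remainder {hT : Matrix (Fin k) (Fin k) ℝ} {hN : Matrix (Fin l) (Fin l) ℝ}
    (hT_det : hT.det ≠ 0) (hN_det : hN.det ≠ 0) (i j : Fin k ⊕ Fin l)
    (K : Σ m : ℕ, Fin m → Fin k ⊕ Fin l) :
    ∃ q : MvPolynomial (JetVar k l) ℝ, (∀ s ∈ q.support, 2 ≤ s.degree) ∧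
      ((i.isLeft ∨ j.isRight) → ∀ G, Admissible hT hN G → iterPd (fun y => G y i j) K.2 0 =
        leadingTerm hT hN G i j (tangentialPart K) (normalPart K) +
          MvPolynomial.eval (jetVal G) q) := by
  by_cases hij : i.isLeft ∨ j.isRight
  · obtain ⟨q, hq, h⟩ := toQuotient_eq_iff.1 (metricClass_eq_leadingTerm hT_det hN_det i j hij
      (tangentialPart K).2 (normalPart K).2)
    -- The polynomial `q` witnesses membership in `polyOrder 2` of a function on all admissible
    -- metrics, so it is fixed before `G`.
    refine ⟨q, hq, fun _ G hG => ?_⟩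
    have := h ⟨G, hG⟩
    -- Partial derivatives commute, so a list in any order may be sorted into its tangential and
    -- normal parts.
    rw [iterPd_eq_jet (hG.smooth i j), mset_eq_parts K]
    exact sub_eq_iff_eq_add'.1 this
  · exact ⟨0, by simp, fun h => absurd h hij⟩

end Indices

end SubmanifoldCoords

/-! ### The proposition for charts on a manifold -/

theorem proposition3p1 (k l : ℕ) (hk : 1 ≤ k) (hl : 1 ≤ l)
    (hT : Matrix (Fin k) (Fin k) ℝ) (hN : Matrix (Fin l) (Fin l) ℝ)
    (hT_symm : hT.IsSymm) (hN_symm : hN.IsSymm) (hT_det : hT.det ≠ 0) (hN_det : hN.det ≠ 0) :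
    -- the universal remainders `Q i j K`, polynomials with all terms of degree at least `2`
    ∃ Q : Fin k ⊕ Fin l → Fin k ⊕ Fin l → (K : Σ m : ℕ, Fin m → Fin k ⊕ Fin l) →
        MvPolynomial (JetVar k l) ℝ,
      (∀ i j K, ∀ s ∈ (Q i j K).support, 2 ≤ s.degree) ∧
      ∀ (M : Type*) [TopologicalSpace M] [ChartedSpace (EuclideanSpace ℝ (Fin (k + l))) M]
        [IsManifold (𝓡 (k + l)) ∞ M] (g : PseudoRiemannianMetric (k + l) M)
        (S : Set M) (p : M) (z : OpenPartialHomeomorph M (Fin k ⊕ Fin l → ℝ)),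
        IsSubmanifoldNormalCoords g S p hT hN z →
        let G := metricCoeff g z
        -- `D i j c` is the partial derivative `g_{ij,c}` at the base point, `rem i j c` the value
        -- of the corresponding remainder
        let D := fun (i j : Fin k ⊕ Fin l) {m : ℕ} (c : Fin m → Fin k ⊕ Fin l) =>
          iterPd (fun y => G y i j) c 0
        let rem := fun (i j : Fin k ⊕ Fin l) {m : ℕ} (c : Fin m → Fin k ⊕ Fin l) =>
          MvPolynomial.eval (jetVal G) (Q i j ⟨m, c⟩)
        -- both indices tangential
        (∀ α β : Fin k,
          D (.inl α) (.inl β) ![] = hT α β + rem (.inl α) (.inl β) ![]) ∧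
        (∀ α β γ : Fin k,
          D (.inl α) (.inl β) ![.inl γ] = 0 + rem (.inl α) (.inl β) ![.inl γ]) ∧
        (∀ (α β : Fin k) (m : ℕ) (γ : Fin (m + 2) → Fin k),
          D (.inl α) (.inl β) (Sum.inl ∘ γ) =
            2 * ((((m + 2 : ℕ) : ℝ) - 1) / (((m + 2 : ℕ) : ℝ) + 1)) *
              symCurvature G (.inl α) (.inl β) (Sum.inl ∘ γ) ![]
            + rem (.inl α) (.inl β) (Sum.inl ∘ γ)) ∧
        (∀ (α β : Fin k) (m : ℕ) (γ : Fin m → Fin k) (γ' : Fin l),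
          D (.inl α) (.inl β) (Fin.append (Sum.inl ∘ γ) ![.inr γ']) =
            -2 * nablaSecondFundamentalForm G m ![α, β] γ' γ 0
            + rem (.inl α) (.inl β) (Fin.append (Sum.inl ∘ γ) ![.inr γ'])) ∧
        (∀ (α β : Fin k) (m n : ℕ) (γ : Fin m → Fin k) (γ' : Fin (n + 2) → Fin l),
          D (.inl α) (.inl β) (Fin.append (Sum.inl ∘ γ) (Sum.inr ∘ γ')) =
            2 * symCurvature G (.inl α) (.inl β) (Sum.inr ∘ γ') (Sum.inl ∘ γ)
            + rem (.inl α) (.inl β) (Fin.append (Sum.inl ∘ γ) (Sum.inr ∘ γ'))) ∧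
        -- one index tangential, one normal
        (∀ (α : Fin k) (β' : Fin l) (m : ℕ) (γ : Fin m → Fin k),
          D (.inl α) (.inr β') (Sum.inl ∘ γ) = 0 + rem (.inl α) (.inr β') (Sum.inl ∘ γ)) ∧
        (∀ (α : Fin k) (β' γ' : Fin l),
          D (.inl α) (.inr β') ![.inr γ'] = 0 + rem (.inl α) (.inr β') ![.inr γ']) ∧
        (∀ (α : Fin k) (β' : Fin l) (m : ℕ) (γ : Fin (m + 1) → Fin k) (γ' : Fin l),
          D (.inl α) (.inr β') (Fin.append (Sum.inl ∘ γ) ![.inr γ']) =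
            -(((m + 1 : ℕ) : ℝ) / (((m + 1 : ℕ) : ℝ) + 1)) *
              symCurvature' G (.inr β') (.inr γ') (.inl α) (Sum.inl ∘ γ)
            + rem (.inl α) (.inr β') (Fin.append (Sum.inl ∘ γ) ![.inr γ'])) ∧
        (∀ (α : Fin k) (β' : Fin l) (m n : ℕ) (γ : Fin m → Fin k) (γ' : Fin (n + 2) → Fin l),
          D (.inl α) (.inr β') (Fin.append (Sum.inl ∘ γ) (Sum.inr ∘ γ')) =
            2 * (((n + 2 : ℕ) : ℝ) / (((n + 2 : ℕ) : ℝ) + 1)) *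
              symCurvature G (.inl α) (.inr β') (Sum.inr ∘ γ') (Sum.inl ∘ γ)
            + rem (.inl α) (.inr β') (Fin.append (Sum.inl ∘ γ) (Sum.inr ∘ γ'))) ∧
        -- both indices normal
        (∀ α' β' : Fin l,
          D (.inr α') (.inr β') ![] = hN α' β' + rem (.inr α') (.inr β') ![]) ∧
        (∀ (α' β' : Fin l) (m : ℕ) (γ : Fin (m + 1) → Fin k),
          D (.inr α') (.inr β') (Sum.inl ∘ γ) = 0 + rem (.inr α') (.inr β') (Sum.inl ∘ γ)) ∧
        (∀ (α' β' : Fin l) (m : ℕ) (γ : Fin m → Fin k) (γ' : Fin l),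
          D (.inr α') (.inr β') (Fin.append (Sum.inl ∘ γ) ![.inr γ']) =
            0 + rem (.inr α') (.inr β') (Fin.append (Sum.inl ∘ γ) ![.inr γ'])) ∧
        (∀ (α' β' : Fin l) (m n : ℕ) (γ : Fin m → Fin k) (γ' : Fin (n + 2) → Fin l),
          D (.inr α') (.inr β') (Fin.append (Sum.inl ∘ γ) (Sum.inr ∘ γ')) =
            2 * ((((n + 2 : ℕ) : ℝ) - 1) / (((n + 2 : ℕ) : ℝ) + 1)) *
              symCurvature G (.inr α') (.inr β') (Sum.inr ∘ γ') (Sum.inl ∘ γ)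
            + rem (.inr α') (.inr β') (Fin.append (Sum.inl ∘ γ) (Sum.inr ∘ γ'))) := by
  -- The remainders depend only on `k`, `l`, `hT`, `hN` and the indices, since they are chosen
  -- before any manifold is introduced.
  choose Q hQ hrem using fun i j K => exists_remainder hT_det hN_det i j K
  refine ⟨Q, hQ, fun M _ _ _ g S p z hz => ?_⟩
  have hG := hz.admissible
  have spec : ∀ (i j : Fin k ⊕ Fin l) (_ : i.isLeft ∨ j.isRight) (m n : ℕ) (γ : Fin m → Fin k)
      (γ' : Fin n → Fin l),
      iterPd (fun y => metricCoeff g z y i j) (Fin.append (Sum.inl ∘ γ) (Sum.inr ∘ γ')) 0 =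
        leadingTerm hT hN (metricCoeff g z) i j ⟨m, γ⟩ ⟨n, γ'⟩ +
          MvPolynomial.eval (jetVal (metricCoeff g z))
            (Q i j ⟨m + n, Fin.append (Sum.inl ∘ γ) (Sum.inr ∘ γ')⟩) := fun i j hij m n γ γ' => by
    rw [hrem i j ⟨m + n, Fin.append (Sum.inl ∘ γ) (Sum.inr ∘ γ')⟩ hij _ hG, tangentialPart_append,
      normalPart_append]
  have spec_inl : ∀ (i j : Fin k ⊕ Fin l) (_ : i.isLeft ∨ j.isRight) (m : ℕ) (γ : Fin m → Fin k),
      iterPd (fun y => metricCoeff g z y i j) (Sum.inl ∘ γ) 0 =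
        leadingTerm hT hN (metricCoeff g z) i j ⟨m, γ⟩ ⟨0, ![]⟩ +
          MvPolynomial.eval (jetVal (metricCoeff g z)) (Q i j ⟨m, Sum.inl ∘ γ⟩) :=
    fun i j hij m γ => by
    rw [hrem i j ⟨m, Sum.inl ∘ γ⟩ hij _ hG, tangentialPart_inl, normalPart_inl]
  have e0 : (![] : Fin 0 → Fin k ⊕ Fin l) = Sum.inl ∘ ![] := Subsingleton.elim _ _
  have e1 : ∀ γ : Fin k, (![.inl γ] : Fin 1 → Fin k ⊕ Fin l) = Sum.inl ∘ ![γ] := fun γ => by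
    ext i
    simp
  have e1' : ∀ γ : Fin l, (![.inr γ] : Fin 1 → Fin k ⊕ Fin l) = Sum.inr ∘ ![γ] := fun γ => by
    ext i
    simp
  -- The remainder is indexed by the tuple itself, so the singleton is rewritten as an append with
  -- an empty tangential part, using that `0 + 1` reduces to `1`.
  have e2 : ∀ γ : Fin l, (![.inr γ] : Fin 1 → Fin k ⊕ Fin l) =
      (Fin.append (Sum.inl ∘ ![]) (Sum.inr ∘ ![γ]) : Fin (0 + 1) → Fin k ⊕ Fin l) := fun γ => by
    ext i
    fin_cases i
    rfl
  intro G D rem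
  refine ⟨fun α β => ?_, fun α β γ => ?_, fun α β m γ => ?_, fun α β m γ γ' => ?_,
    fun α β m n γ γ' => ?_, fun α β' m γ => ?_, fun α β' γ' => ?_, fun α β' m γ γ' => ?_,
    fun α β' m n γ γ' => ?_, fun α' β' => ?_, fun α' β' m γ => ?_, fun α' β' m γ γ' => ?_,
    fun α' β' m n γ γ' => ?_⟩
  · rw [e0]
    exact spec_inl (.inl α) (.inl β) (.inl rfl) 0 ![]
  · rw [e1]
    exact spec_inl (.inl α) (.inl β) (.inl rfl) 1 ![γ]
  · exact spec_inl (.inl α) (.inl β) (.inl rfl) (m + 2) γ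
  · rw [e1']
    simpa only [leadingTerm, Matrix.cons_val_zero] using spec (.inl α) (.inl β) (.inl rfl) m 1 γ ![γ']
  · simpa only [leadingTerm] using spec (.inl α) (.inl β) (.inl rfl) m (n + 2) γ γ'
  · exact spec_inl (.inl α) (.inr β') (.inl rfl) m γ
  · rw [e2]
    exact spec (.inl α) (.inr β') (.inl rfl) 0 1 ![] ![γ']
  · rw [e1']
    exact spec (.inl α) (.inr β') (.inl rfl) (m + 1) 1 γ ![γ']
  · simpa only [leadingTerm] using spec (.inl α) (.inr β') (.inl rfl) m (n + 2) γ γ'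
  · rw [e0]
    exact spec_inl (.inr α') (.inr β') (.inr rfl) 0 ![]
  · exact spec_inl (.inr α') (.inr β') (.inr rfl) (m + 1) γ
  · rw [e1']
    simpa only [leadingTerm] using spec (.inr α') (.inr β') (.inr rfl) m 1 γ ![γ']
  · simpa only [leadingTerm] using spec (.inr α') (.inr β') (.inr rfl) m (n + 2) γ γ'
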